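/- Let $n\ge 2$ and let $\Omega\subset\mathbb{R}^n_x\times\mathbb{R}_t$ be a bounded open set. There exist $v\in L^\infty(\mathbb{R}^n_x\times\mathbb{R}_t;\mathbb{R}^n)$ and $p\in L^\infty(\mathbb{R}^n_x\times\mathbb{R}_t)$ which solve the Euler equations $$\partial_t v+\operatorname{div}(v\otimes v)+\nabla p=0,\qquad \operatorname{div}v=0$$ in the sense of distributions on $\mathbb{R}^n_x\times\mathbb{R}_t$ and satisfy - $|v(x,t)|=1$ for a.e. $(x,t)\in\Omega$, - $v(x,t)=0$ and $p(x,t)=0$ for a.e. $(x,t)\in(\mathbb{R}^n_x\times\mathbb{R}_t)\setminus\Omega$. Moreover, there exist sequences $v_k,f_k\in C_c^\infty(\Omega;\mathbb{R}^n)$ and $p_k\in C_c^\infty(\Omega)$ such that for every $k$ $$\partial_t v_k+\operatorname{div}(v_k\otimes v_k)+\nabla p_k=f_k,\qquad \operatorname{div}v_k=0,$$ and - $f_k\to0$ in $H^{-1}(\mathbb{R}^n_x\times\mathbb{R}_t;\mathbb{R}^n)$, the dual of $H^1(\mathbb{R}^n_x\times\mathbb{R}_t;\mathbb{R}^n)$,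 - $\sup_k\left(\|v_k\|_{L^\infty}+\|p_k\|_{L^\infty}\right)<\infty$, - $v_k\to v$ and $p_k\to p$ in $L^q(\mathbb{R}^n_x\times\mathbb{R}_t)$ for every $0<q<\infty$. -/

import Mathlib

open MeasureTheory Filter Topology
open scoped ENNReal NNReal Distributions

noncomputable section

namespace Euler

/-- Velocity (and position) space `ℝⁿ` with the Euclidean norm. -/
abbrev Space (n : ℕ) : Type := EuclideanSpace ℝ (Fin n)

/-- Space-time `ℝⁿₓ × ℝₜ`, with Lebesgue measure `volume`. -/
abbrev SpaceTime (n : ℕ) : Type := Space n × ℝ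

/-- The partial derivative `∂g/∂x_j`. -/
def dx {n : ℕ} {F : Type*} [NormedAddCommGroup F] [NormedSpace ℝ F]
    (j : Fin n) (g : SpaceTime n → F) (z : SpaceTime n) : F :=
  fderiv ℝ g z (EuclideanSpace.single j 1, 0)

/-- The time derivative `∂g/∂t`. -/
def dt {n : ℕ} {F : Type*} [NormedAddCommGroup F] [NormedSpace ℝ F]
    (g : SpaceTime n → F) (z : SpaceTime n) : F :=
  fderiv ℝ g z (0, 1)

/-- The divergence in the space variables, `∑ⱼ ∂ⱼ wⱼ`. -/
def divx {n : ℕ} (w : SpaceTime n → Space n) (z : SpaceTime n) : ℝ :=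
  ∑ j, dx j (fun y => w y j) z

/-- Classical solutions of `∂ₜv + div (v ⊗ v) + ∇p = f`, `div v = 0`
(used for smooth `v`, `p` only). -/
structure IsClassicalSolution {n : ℕ} (v : SpaceTime n → Space n) (p : SpaceTime n → ℝ)
    (f : SpaceTime n → Space n) : Prop where
  momentum : ∀ z, ∀ i : Fin n,
    dt (fun y => v y i) z + ∑ j, dx j (fun y => v y i * v y j) z + dx i p z = f z i
  incompressible : ∀ z, divx v z = 0

/-- Weak solutions: `∂ₜv + div (v ⊗ v) + ∇p = f`, `div v = 0` in the sense of distributions on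
`ℝⁿₓ × ℝₜ`, with `v ∈ L²_loc` and `p, f ∈ L¹_loc`. -/
structure IsWeakSolution {n : ℕ} (v : SpaceTime n → Space n) (p : SpaceTime n → ℝ)
    (f : SpaceTime n → Space n) : Prop where
  aestronglyMeasurable : AEStronglyMeasurable v volume
  sq_locallyIntegrable : LocallyIntegrable (fun z => ‖v z‖ ^ 2) volume
  pressure_locallyIntegrable : LocallyIntegrable p volume
  force_locallyIntegrable : LocallyIntegrable f volume
  momentum : ∀ φ : 𝓓((⊤ : TopologicalSpace.Opens (SpaceTime n)), Space n),
    ∫ z, ((∑ i, v z i * dt (fun y => φ y i) z)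
      + (∑ i, ∑ j, v z i * v z j * dx j (fun y => φ y i) z)
      + p z * divx φ z
      + ∑ i, f z i * φ z i) = 0
  incompressible : ∀ ψ : 𝓓((⊤ : TopologicalSpace.Opens (SpaceTime n)), ℝ),
    ∫ z, ∑ j, v z j * dx j ψ z = 0

/-- The squared `H¹(ℝⁿₓ × ℝₜ; ℝⁿ)` norm of a test function, all `n + 1` first derivatives being
taken into account. -/
def h1NormSq {n : ℕ} (φ : 𝓓((⊤ : TopologicalSpace.Opens (SpaceTime n)), Space n)) : ℝ :=
  ∫ z, (‖φ z‖ ^ 2 + ‖dt φ z‖ ^ 2 + ∑ j, ‖dx j φ z‖ ^ 2)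

/-- The norm of `f` in `H⁻¹(ℝⁿₓ × ℝₜ; ℝⁿ)`, the dual of `H¹`. Since test functions are dense in
`H¹`, the supremum may be taken over test functions. -/
def hNegOneNorm {n : ℕ} (f : SpaceTime n → Space n) : ℝ≥0∞ :=
  ⨆ φ : 𝓓((⊤ : TopologicalSpace.Opens (SpaceTime n)), Space n), ⨆ _ : h1NormSq φ ≤ 1,
    ENNReal.ofReal |∫ z, ∑ i, f z i * φ z i|

end Euler

end

noncomputable section

open scoped ContDiff

namespace Euler

section DirectionalDerivative

variable {E : Type*} [NormedAddCommGroup E] [NormedSpace ℝ E]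

/-- The derivative of `f` in the fixed direction `w`, as an operator on functions. -/
def dirDeriv (w : E) (f : E → ℝ) : E → ℝ := fun z => fderiv ℝ f z w

theorem contDiff_dirDeriv {f : E → ℝ} (hf : ContDiff ℝ ∞ f) (w : E) :
    ContDiff ℝ ∞ (dirDeriv w f) :=
  (hf.fderiv_right (m := ∞) (by simp)).clm_apply contDiff_const

theorem hasCompactSupport_dirDeriv {f : E → ℝ} (hf : HasCompactSupport f) (w : E) :
    HasCompactSupport (dirDeriv w f) :=
  hf.fderiv_apply ℝ w

theorem tsupport_dirDeriv_subset (f : E → ℝ) (w : E) :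
    tsupport (dirDeriv w f) ⊆ tsupport f :=
  tsupport_fderiv_apply_subset ℝ w

theorem dirDeriv_eq_zero {f : E → ℝ} (w : E) {z : E} (hz : z ∉ tsupport f) :
    dirDeriv w f z = 0 :=
  image_eq_zero_of_notMem_tsupport fun h => hz (tsupport_dirDeriv_subset f w h)

theorem differentiable_of_smooth {F : Type*} [NormedAddCommGroup F] [NormedSpace ℝ F]
    {f : E → F} (hf : ContDiff ℝ ∞ f) : Differentiable ℝ f :=
  hf.differentiable (by simp)

theorem dirDeriv_comm {f : E → ℝ} (hf : ContDiff ℝ ∞ f) (w w' : E) :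
    dirDeriv w (dirDeriv w' f) = dirDeriv w' (dirDeriv w f) := by
  have key : ∀ (a b : E) (z : E),
      dirDeriv a (dirDeriv b f) z = fderiv ℝ (fderiv ℝ f) z a b := by
    intro a b z
    have hd : DifferentiableAt ℝ (fderiv ℝ f) z :=
      differentiable_of_smooth (hf.fderiv_right (m := ∞) (by simp)) z
    change fderiv ℝ (fun y => fderiv ℝ f y b) z a = _
    rw [(hd.hasFDerivAt.clm_apply (hasFDerivAt_const b z)).fderiv]
    simp
  funext z
  rw [key, key]
  exact (hf.contDiffAt.isSymmSndFDerivAt (by simpa using WithTop.coe_le_coe.2 (le_top : (2 : ℕ∞) ≤ ⊤))).eq w w'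

theorem dirDeriv_add {f g : E → ℝ} (hf : ContDiff ℝ ∞ f) (hg : ContDiff ℝ ∞ g) (w z : E) :
    dirDeriv w (fun y => f y + g y) z = dirDeriv w f z + dirDeriv w g z := by
  simp only [dirDeriv]
  rw [fderiv_fun_add (differentiable_of_smooth hf z) (differentiable_of_smooth hg z)]
  rfl

theorem dirDeriv_const_mul {f : E → ℝ} (hf : ContDiff ℝ ∞ f) (c : ℝ) (w z : E) :
    dirDeriv w (fun y => c * f y) z = c * dirDeriv w f z := by
  simp only [dirDeriv]
  rw [fderiv_const_mul (differentiable_of_smooth hf z)]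
  rfl

theorem dirDeriv_add_left (f : E → ℝ) (w w' z : E) :
    dirDeriv (w + w') f z = dirDeriv w f z + dirDeriv w' f z := by
  simp [dirDeriv]

/-- The oscillation `N⁻² χ(z) cos (N η(z))` with amplitude `χ` and phase `η`. -/
def oscillation (χ : E → ℝ) (η : E →L[ℝ] ℝ) (N : ℝ) (z : E) : ℝ :=
  (N ^ 2)⁻¹ * (χ z * Real.cos (N * η z))

theorem contDiff_oscillation {χ : E → ℝ} (hχ : ContDiff ℝ ∞ χ) (η : E →L[ℝ] ℝ) (N : ℝ) :
    ContDiff ℝ ∞ (oscillation χ η N) := by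
  have h1 : ContDiff ℝ ∞ (fun z => Real.cos (N * η z)) :=
    Real.contDiff_cos.comp (contDiff_const.mul η.contDiff)
  exact contDiff_const.mul (hχ.mul h1)

theorem tsupport_oscillation_subset (χ : E → ℝ) (η : E →L[ℝ] ℝ) (N : ℝ) :
    tsupport (oscillation χ η N) ⊆ tsupport χ := by
  apply closure_mono
  intro z hz
  rw [Function.mem_support] at hz ⊢
  intro h
  exact hz (by simp [oscillation, h])

theorem hasCompactSupport_oscillation {χ : E → ℝ} (hχ : HasCompactSupport χ) (η : E →L[ℝ] ℝ)
    (N : ℝ) : HasCompactSupport (oscillation χ η N) :=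
  hχ.of_isClosed_subset (isClosed_tsupport _) (tsupport_oscillation_subset χ η N)

theorem abs_oscillation_le (χ : E → ℝ) (η : E →L[ℝ] ℝ) (N : ℝ) (z : E) :
    |oscillation χ η N z| ≤ (N ^ 2)⁻¹ * |χ z| := by
  rw [oscillation, abs_mul, abs_mul, abs_of_nonneg (by positivity : 0 ≤ (N ^ 2)⁻¹)]
  have := Real.abs_cos_le_one (N * η z)
  gcongr
  nlinarith [abs_nonneg (χ z)]

theorem hasFDerivAt_phase (η : E →L[ℝ] ℝ) (N : ℝ) (z : E) :
    HasFDerivAt (fun z => N * η z) (N • η) z :=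
  η.hasFDerivAt.const_mul N

theorem dirDeriv_mul_cos {a : E → ℝ} (ha : ContDiff ℝ ∞ a) (η : E →L[ℝ] ℝ) (N : ℝ) (w z : E) :
    dirDeriv w (fun z => a z * Real.cos (N * η z)) z
      = dirDeriv w a z * Real.cos (N * η z) - N * η w * a z * Real.sin (N * η z) := by
  have h := ((differentiable_of_smooth ha z).hasFDerivAt).fun_mul (hasFDerivAt_phase η N z).cos
  change fderiv ℝ _ z w = _
  rw [h.fderiv]
  simp [dirDeriv]
  ring

theorem dirDeriv_mul_sin {a : E → ℝ} (ha : ContDiff ℝ ∞ a) (η : E →L[ℝ] ℝ) (N : ℝ) (w z : E) :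
    dirDeriv w (fun z => a z * Real.sin (N * η z)) z
      = dirDeriv w a z * Real.sin (N * η z) + N * η w * a z * Real.cos (N * η z) := by
  have h := ((differentiable_of_smooth ha z).hasFDerivAt).fun_mul (hasFDerivAt_phase η N z).sin
  change fderiv ℝ _ z w = _
  rw [h.fderiv]
  simp [dirDeriv]
  ring

theorem dirDeriv_dirDeriv_oscillation {χ : E → ℝ} (hχ : ContDiff ℝ ∞ χ) (η : E →L[ℝ] ℝ)
    {N : ℝ} (hN : N ≠ 0) (w w' z : E) :
    dirDeriv w (dirDeriv w' (oscillation χ η N)) z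
      = -(η w * η w' * χ z * Real.cos (N * η z))
        + (N ^ 2)⁻¹ * (dirDeriv w (dirDeriv w' χ) z * Real.cos (N * η z))
        - N⁻¹ * ((η w * dirDeriv w' χ z + η w' * dirDeriv w χ z) * Real.sin (N * η z)) := by
  have hc : ContDiff ℝ ∞ (fun z => Real.cos (N * η z)) :=
    Real.contDiff_cos.comp (contDiff_const.mul η.contDiff)
  have hs : ContDiff ℝ ∞ (fun z => Real.sin (N * η z)) :=
    Real.contDiff_sin.comp (contDiff_const.mul η.contDiff)
  have hχ' := contDiff_dirDeriv hχ w'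
  have h1 : dirDeriv w' (oscillation χ η N) = fun z => (N ^ 2)⁻¹ *
      (dirDeriv w' χ z * Real.cos (N * η z) + (-(N * η w')) * (χ z * Real.sin (N * η z))) := by
    funext y
    change dirDeriv w' (fun z => (N ^ 2)⁻¹ * (χ z * Real.cos (N * η z))) y = _
    rw [dirDeriv_const_mul (hχ.mul hc), dirDeriv_mul_cos hχ]
    ring
  rw [h1, dirDeriv_const_mul ((hχ'.mul hc).add (contDiff_const.mul (hχ.mul hs))),
    dirDeriv_add (hχ'.mul hc) (contDiff_const.mul (hχ.mul hs)),
    dirDeriv_const_mul (hχ.mul hs), dirDeriv_mul_cos hχ', dirDeriv_mul_sin hχ]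
  field_simp
  ring

theorem exists_bound_dirDeriv_dirDeriv_oscillation {χ : E → ℝ} (hχ : ContDiff ℝ ∞ χ)
    (hχc : HasCompactSupport χ) (η : E →L[ℝ] ℝ) (w w' : E) :
    ∃ C : ℝ, ∀ N : ℝ, 1 ≤ N → ∀ z,
      |dirDeriv w (dirDeriv w' (oscillation χ η N)) z + η w * η w' * χ z * Real.cos (N * η z)|
        ≤ C / N := by
  obtain ⟨C₁, h₁⟩ := (contDiff_dirDeriv (contDiff_dirDeriv hχ w') w).continuous
    |>.bounded_above_of_compact_support
      (hasCompactSupport_dirDeriv (hasCompactSupport_dirDeriv hχc w') w)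
  obtain ⟨C₂, h₂⟩ := (contDiff_dirDeriv hχ w').continuous.bounded_above_of_compact_support
      (hasCompactSupport_dirDeriv hχc w')
  obtain ⟨C₃, h₃⟩ := (contDiff_dirDeriv hχ w).continuous.bounded_above_of_compact_support
      (hasCompactSupport_dirDeriv hχc w)
  refine ⟨C₁ + (|η w| * C₂ + |η w'| * C₃), fun N hN z => ?_⟩
  have hN0 : 0 < N := by linarith
  rw [dirDeriv_dirDeriv_oscillation hχ η hN0.ne']
  have e : ∀ a b c : ℝ, -a + b - c + a = b - c := by intros; ring
  rw [e]
  have hb : |(N ^ 2)⁻¹ * (dirDeriv w (dirDeriv w' χ) z * Real.cos (N * η z))| ≤ N⁻¹ * C₁ := by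
    rw [abs_mul, abs_mul, abs_of_nonneg (by positivity : 0 ≤ (N ^ 2)⁻¹)]
    have hC : 0 ≤ C₁ := (norm_nonneg _).trans (h₁ z)
    have i1 : (N ^ 2)⁻¹ ≤ N⁻¹ := by
      apply inv_anti₀ hN0
      nlinarith
    have i2 : |dirDeriv w (dirDeriv w' χ) z| * |Real.cos (N * η z)| ≤ C₁ * 1 :=
      mul_le_mul (h₁ z) (Real.abs_cos_le_one _) (abs_nonneg _) hC
    rw [mul_one] at i2
    exact mul_le_mul i1 i2 (by positivity) (by positivity)
  have hc : |N⁻¹ * ((η w * dirDeriv w' χ z + η w' * dirDeriv w χ z) * Real.sin (N * η z))|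
      ≤ N⁻¹ * (|η w| * C₂ + |η w'| * C₃) := by
    rw [abs_mul, abs_mul, abs_of_nonneg (by positivity : 0 ≤ N⁻¹)]
    have i1 : |η w * dirDeriv w' χ z + η w' * dirDeriv w χ z| ≤ |η w| * C₂ + |η w'| * C₃ := by
      refine (abs_add_le _ _).trans ?_
      rw [abs_mul, abs_mul]
      exact add_le_add (mul_le_mul_of_nonneg_left (h₂ z) (abs_nonneg _))
        (mul_le_mul_of_nonneg_left (h₃ z) (abs_nonneg _))
    have i2 := mul_le_mul i1 (Real.abs_sin_le_one (N * η z)) (abs_nonneg _)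
      ((abs_nonneg _).trans i1)
    rw [mul_one] at i2
    exact mul_le_mul_of_nonneg_left i2 (by positivity)
  calc _ ≤ _ := abs_sub _ _
    _ ≤ N⁻¹ * C₁ + N⁻¹ * (|η w| * C₂ + |η w'| * C₃) := add_le_add hb hc
    _ = _ := by field_simp

variable [FiniteDimensional ℝ E] [MeasurableSpace E] [BorelSpace E]
  (μ : Measure E) [μ.IsAddHaarMeasure]

theorem integral_mul_dirDeriv {f g : E → ℝ} (hf : ContDiff ℝ ∞ f) (hg : ContDiff ℝ ∞ g)
    (hc : HasCompactSupport f) (w : E) :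
    ∫ z, f z * dirDeriv w g z ∂μ = -∫ z, dirDeriv w f z * g z ∂μ := by
  refine integral_mul_fderiv_eq_neg_fderiv_mul_of_integrable ?_ ?_ ?_
    (fun x _ => differentiable_of_smooth hf x) (fun x _ => differentiable_of_smooth hg x)
  · exact ((contDiff_dirDeriv hf w).continuous.mul hg.continuous).integrable_of_hasCompactSupport
      (hasCompactSupport_dirDeriv hc w).mul_right
  · exact (hf.continuous.mul (contDiff_dirDeriv hg w).continuous).integrable_of_hasCompactSupport
      hc.mul_right
  · exact (hf.continuous.mul hg.continuous).integrable_of_hasCompactSupport hc.mul_right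

theorem integral_dirDeriv_mul {f g : E → ℝ} (hf : ContDiff ℝ ∞ f) (hg : ContDiff ℝ ∞ g)
    (hc : HasCompactSupport g) (w : E) :
    ∫ z, f z * dirDeriv w g z ∂μ = -∫ z, dirDeriv w f z * g z ∂μ := by
  have h := integral_mul_dirDeriv μ hg hf hc w
  simp only [mul_comm (g _)] at h
  rw [h, neg_neg]
  simp only [mul_comm]

theorem integral_dirDeriv {f : E → ℝ} (hf : ContDiff ℝ ∞ f) (hc : HasCompactSupport f) (w : E) :
    ∫ z, dirDeriv w f z ∂μ = 0 := by
  have h := integral_dirDeriv_mul μ (contDiff_const (c := (1 : ℝ))) hf hc w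
  simpa [dirDeriv] using h

/-- Second derivatives of high-frequency oscillations converge weakly to zero. -/
theorem tendsto_integral_dirDeriv_oscillation_mul {χ ψ : E → ℝ} (hχ : ContDiff ℝ ∞ χ)
    (hχc : HasCompactSupport χ) (hψ : ContDiff ℝ ∞ ψ) (η : E →L[ℝ] ℝ) (w w' : E) :
    Tendsto (fun k : ℕ => ∫ z, dirDeriv w (dirDeriv w' (oscillation χ η (k + 1))) z * ψ z ∂μ)
      atTop (𝓝 0) := by
  have hint : Integrable (fun z => |χ z| * |dirDeriv w' (dirDeriv w ψ) z|) μ :=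
    (hχ.continuous.abs.mul
      (contDiff_dirDeriv (contDiff_dirDeriv hψ w) w').continuous.abs).integrable_of_hasCompactSupport
      ((hχc.comp_left (g := fun x : ℝ => |x|) abs_zero).mul_right)
  have hbd : ∀ k : ℕ, |∫ z, dirDeriv w (dirDeriv w' (oscillation χ η (k + 1))) z * ψ z ∂μ|
      ≤ (((k : ℝ) + 1) ^ 2)⁻¹ * ∫ z, |χ z| * |dirDeriv w' (dirDeriv w ψ) z| ∂μ := by
    intro k
    have ho := contDiff_oscillation hχ η ((k : ℝ) + 1)
    have hoc := hasCompactSupport_oscillation hχc η ((k : ℝ) + 1)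
    have e1 := integral_mul_dirDeriv μ (contDiff_dirDeriv ho w') hψ
      (hasCompactSupport_dirDeriv hoc w') w
    have e2 := integral_mul_dirDeriv μ ho (contDiff_dirDeriv hψ w) hoc w'
    have e3 : ∫ z, dirDeriv w (dirDeriv w' (oscillation χ η (k + 1))) z * ψ z ∂μ
        = ∫ z, oscillation χ η (k + 1) z * dirDeriv w' (dirDeriv w ψ) z ∂μ := by
      linarith
    rw [e3, ← integral_const_mul]
    refine (abs_integral_le_integral_abs).trans (integral_mono ?_ (hint.const_mul _) fun z => ?_)
    · exact ((ho.continuous.mul (contDiff_dirDeriv (contDiff_dirDeriv hψ w) w').continuous)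
        |>.integrable_of_hasCompactSupport hoc.mul_right).abs
    · simp only [abs_mul]
      rw [← mul_assoc]
      exact mul_le_mul_of_nonneg_right (abs_oscillation_le χ η _ z) (abs_nonneg _)
  apply squeeze_zero_norm hbd
  rw [← zero_mul (∫ z, |χ z| * |dirDeriv w' (dirDeriv w ψ) z| ∂μ)]
  apply Tendsto.mul_const
  have h := tendsto_one_div_add_atTop_nhds_zero_nat (𝕜 := ℝ)
  have h2 := h.mul h
  simp only [mul_zero] at h2
  refine h2.congr fun k => ?_
  field_simp

end DirectionalDerivative

open scoped Matrix

/-- Values of the relaxed variables: a velocity together with a momentum flux. -/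
abbrev State (n : ℕ) : Type := Space n × (Fin n → Fin n → ℝ)

/-- The trace of the momentum flux. -/
def fluxTrace {n : ℕ} (P : State n) : ℝ := ∑ k, P.2 k k

/-- The Reynolds stress `I/n + (M - (tr M/n) I) - v ⊗ v` of a state `(v, M)`. -/
def stress {n : ℕ} (P : State n) : Matrix (Fin n) (Fin n) ℝ :=
  Matrix.of fun i j => (if i = j then (1 - fluxTrace P) / n else 0) + P.2 i j - P.1 i * P.1 j

/-- The states whose Reynolds stress is positive definite: the interior of the convex hull of the
states `(v, v ⊗ v + p I)` with `|v| = 1`. -/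
def relaxedSet (n : ℕ) : Set (State n) :=
  {P | ∀ x : Fin n → ℝ, x ≠ 0 → 0 < x ⬝ᵥ (stress P *ᵥ x)}

section StressAlgebra

variable {n : ℕ}

theorem stress_apply (P : State n) (i j : Fin n) :
    stress P i j = (if i = j then (1 - fluxTrace P) / n else 0) + P.2 i j - P.1 i * P.1 j := rfl

theorem continuous_fluxTrace : Continuous (fluxTrace (n := n)) := by
  unfold fluxTrace
  fun_prop

theorem continuous_stress : Continuous (stress (n := n)) := by
  refine continuous_matrix fun i j => ?_
  simp only [stress_apply]
  have := continuous_fluxTrace (n := n)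
  split_ifs <;> fun_prop

theorem isOpen_relaxedSet (n : ℕ) : IsOpen (relaxedSet n) := by
  have h : relaxedSet n
      = {P | ∀ x ∈ Metric.sphere (0 : Fin n → ℝ) 1, 0 < x ⬝ᵥ (stress P *ᵥ x)} := by
    ext P
    constructor
    · intro hP x hx
      apply hP x
      rintro rfl
      simp at hx
    · intro hP x hx
      have hx' : 0 < ‖x‖ := norm_pos_iff.2 hx
      have h1 := hP (‖x‖⁻¹ • x) (by
        rw [mem_sphere_zero_iff_norm, norm_smul, norm_inv, norm_norm, inv_mul_cancel₀ hx'.ne'])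
      rw [Matrix.mulVec_smul, smul_dotProduct, dotProduct_smul, smul_eq_mul, smul_eq_mul] at h1
      have h2 : 0 < ‖x‖⁻¹ := inv_pos.2 hx'
      exact pos_of_mul_pos_right (pos_of_mul_pos_right h1 h2.le) h2.le
  rw [h, isOpen_iff_eventually]
  intro P hP
  refine (isCompact_sphere (0 : Fin n → ℝ) 1).eventually_forall_of_forall_eventually ?_
  intro x hx
  have hc : Continuous fun q : State n × (Fin n → ℝ) => q.2 ⬝ᵥ (stress q.1 *ᵥ q.2) := by
    have := (continuous_stress (n := n)).comp (continuous_fst (X := State n) (Y := Fin n → ℝ))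
    exact Continuous.dotProduct continuous_snd (this.matrix_mulVec continuous_snd)
  exact hc.continuousAt.eventually (lt_mem_nhds (hP x hx))

theorem stress_symm {P : State n} (hP : ∀ i j, P.2 i j = P.2 j i) (i j : Fin n) :
    stress P i j = stress P j i := by
  simp only [stress_apply, hP i j, eq_comm (a := i), mul_comm (P.1 i)]

theorem norm_sq_eq_sum (v : Space n) : ‖v‖ ^ 2 = ∑ i, v i * v i := by
  rw [EuclideanSpace.real_norm_sq_eq]
  simp only [sq]

theorem sum_stress_diag (hn : 0 < n) (P : State n) : ∑ i, stress P i i = 1 - ‖P.1‖ ^ 2 := by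
  have hn' : (n : ℝ) ≠ 0 := by positivity
  simp only [stress_apply, if_true, Finset.sum_sub_distrib, Finset.sum_add_distrib,
    norm_sq_eq_sum, Finset.sum_const, Finset.card_univ, Fintype.card_fin, nsmul_eq_mul, fluxTrace]
  field_simp
  ring

theorem form_single (A : Matrix (Fin n) (Fin n) ℝ) (i j : Fin n) :
    (Pi.single i (1 : ℝ)) ⬝ᵥ (A *ᵥ Pi.single j 1) = A i j := by
  simp

theorem form_add_smul {A : Matrix (Fin n) (Fin n) ℝ} (hA : ∀ i j, A i j = A j i)
    (x y : Fin n → ℝ) (t : ℝ) :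
    (x + t • y) ⬝ᵥ (A *ᵥ (x + t • y))
      = x ⬝ᵥ (A *ᵥ x) + 2 * t * (y ⬝ᵥ (A *ᵥ x)) + t ^ 2 * (y ⬝ᵥ (A *ᵥ y)) := by
  have hT : Aᵀ = A := by ext i j; exact hA j i
  have h : x ⬝ᵥ (A *ᵥ y) = y ⬝ᵥ (A *ᵥ x) := by
    rw [Matrix.dotProduct_mulVec, ← Matrix.mulVec_transpose, hT, dotProduct_comm]
  simp only [Matrix.mulVec_add, Matrix.mulVec_smul, add_dotProduct, dotProduct_add,
    smul_dotProduct, dotProduct_smul, smul_eq_mul, h]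
  ring

/-- The Cauchy–Schwarz inequality for a positive semidefinite symmetric matrix. -/
theorem form_sq_le {A : Matrix (Fin n) (Fin n) ℝ} (hA : ∀ i j, A i j = A j i)
    (hpos : ∀ x : Fin n → ℝ, 0 ≤ x ⬝ᵥ (A *ᵥ x)) (x y : Fin n → ℝ) :
    (y ⬝ᵥ (A *ᵥ x)) ^ 2 ≤ (x ⬝ᵥ (A *ᵥ x)) * (y ⬝ᵥ (A *ᵥ y)) := by
  have h : ∀ t : ℝ, 0 ≤ (y ⬝ᵥ (A *ᵥ y)) * (t * t) + 2 * (y ⬝ᵥ (A *ᵥ x)) * t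
      + (x ⬝ᵥ (A *ᵥ x)) := fun t => by
    have := hpos (x + t • y)
    rw [form_add_smul hA] at this
    linarith
  have := discrim_le_zero h
  rw [discrim] at this
  linarith

variable {P : State n}

theorem form_nonneg (hP : P ∈ relaxedSet n) (x : Fin n → ℝ) : 0 ≤ x ⬝ᵥ (stress P *ᵥ x) := by
  by_cases hx : x = 0
  · simp [hx]
  · exact (hP x hx).le

theorem stress_diag_pos (hP : P ∈ relaxedSet n) (i : Fin n) : 0 < stress P i i := by
  have h := hP (Pi.single i 1) (by simp)
  rwa [form_single] at h

theorem norm_lt_one (hn : 0 < n) (hP : P ∈ relaxedSet n) : ‖P.1‖ ^ 2 < 1 := by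
  have : Nonempty (Fin n) := ⟨⟨0, hn⟩⟩
  have h := sum_stress_diag hn P
  have h2 : 0 < ∑ i, stress P i i :=
    Finset.sum_pos (fun i _ => stress_diag_pos hP i) Finset.univ_nonempty
  linarith

theorem abs_stress_le (hn : 0 < n) (hs : ∀ i j, P.2 i j = P.2 j i) (hP : P ∈ relaxedSet n)
    (i j : Fin n) : |stress P i j| ≤ 1 - ‖P.1‖ ^ 2 := by
  have hd : ∀ k, stress P k k ≤ 1 - ‖P.1‖ ^ 2 := fun k => by
    rw [← sum_stress_diag hn]
    exact Finset.single_le_sum (f := fun k => stress P k k)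
      (fun i _ => (stress_diag_pos hP i).le) (Finset.mem_univ k)
  have h := form_sq_le (stress_symm hs) (form_nonneg hP) (Pi.single j 1) (Pi.single i 1)
  simp only [form_single] at h
  have h0 : 0 ≤ 1 - ‖P.1‖ ^ 2 := (stress_diag_pos hP i).le.trans (hd i)
  apply abs_le_of_sq_le_sq _ h0
  refine h.trans ?_
  rw [sq]
  exact mul_le_mul (hd j) (hd i) (stress_diag_pos hP i).le h0

/-- A positive definite stress dominates a rank-one matrix of comparable trace. -/
theorem exists_direction (hn : 0 < n) (hs : ∀ i j, P.2 i j = P.2 j i) (hP : P ∈ relaxedSet n) :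
    ∃ e : Space n, ‖e‖ = 1 ∧
      ∀ x : Fin n → ℝ, (1 - ‖P.1‖ ^ 2) / n * (x ⬝ᵥ e.ofLp) ^ 2 ≤ x ⬝ᵥ (stress P *ᵥ x) := by
  have hne : Nonempty (Fin n) := ⟨⟨0, hn⟩⟩
  have hn' : (0 : ℝ) < n := by positivity
  obtain ⟨i, -, hi⟩ : ∃ i ∈ Finset.univ, (1 - ‖P.1‖ ^ 2) / n ≤ stress P i i := by
    apply Finset.exists_le_of_sum_le (s := Finset.univ) Finset.univ_nonempty
    rw [sum_stress_diag hn]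
    simp only [Finset.sum_const, Finset.card_univ, Fintype.card_fin, nsmul_eq_mul]
    apply le_of_eq
    field_simp
  set a := stress P i i with ha
  have ha0 : 0 < a := stress_diag_pos hP i
  let g : Space n := WithLp.toLp 2 (stress P *ᵥ Pi.single i 1)
  have hgi : g i = a := by simp [g, ha]
  have hga : a ≤ ‖g‖ := by
    have := PiLp.norm_apply_le g i
    rw [hgi, Real.norm_eq_abs, abs_of_pos ha0] at this
    exact this
  have hg0 : 0 < ‖g‖ := ha0.trans_le hga
  refine ⟨‖g‖⁻¹ • g, ?_, fun x => ?_⟩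
  · rw [norm_smul, norm_inv, norm_norm, inv_mul_cancel₀ hg0.ne']
  have hcs := form_sq_le (stress_symm hs) (form_nonneg hP) (Pi.single i 1) x
  rw [form_single, ← ha] at hcs
  have hx0 := form_nonneg hP x
  have e1 : x ⬝ᵥ (‖g‖⁻¹ • g).ofLp = ‖g‖⁻¹ * (x ⬝ᵥ (stress P *ᵥ Pi.single i 1)) := by
    rw [WithLp.ofLp_smul, dotProduct_smul, smul_eq_mul]
  rw [e1, mul_pow]
  set b := x ⬝ᵥ (stress P *ᵥ Pi.single i 1)
  set q := x ⬝ᵥ (stress P *ᵥ x)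
  have h1 : (1 - ‖P.1‖ ^ 2) / n * (‖g‖⁻¹ ^ 2 * b ^ 2) ≤ a * (‖g‖⁻¹ ^ 2 * (a * q)) :=
    mul_le_mul hi (mul_le_mul_of_nonneg_left hcs (by positivity)) (by positivity) ha0.le
  have h2 : (a * ‖g‖⁻¹) ^ 2 ≤ 1 := by
    apply pow_le_one₀ (by positivity)
    rw [← div_eq_mul_inv, div_le_one hg0]
    exact hga
  calc _ ≤ _ := h1
    _ = (a * ‖g‖⁻¹) ^ 2 * q := by ring
    _ ≤ 1 * q := mul_le_mul_of_nonneg_right h2 hx0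
    _ = q := one_mul q

/-- The direction `(e, e ⊗ u + u ⊗ e)` in state space. -/
def waveDirection (e u : Space n) : State n := (e, fun i j => e i * u j + u i * e j)

theorem exists_wave_segment (hn : 0 < n) (hs : ∀ i j, P.2 i j = P.2 j i)
    (hP : P ∈ relaxedSet n) :
    ∃ e u : Space n, ‖e‖ = 1 ∧ inner ℝ e u = (0 : ℝ) ∧
      ∀ θ ∈ Set.Icc (-1 : ℝ) 1,
        P + (θ * ((1 - ‖P.1‖ ^ 2) / (4 * n))) • waveDirection e u ∈ relaxedSet n := by
  have hn' : (1 : ℝ) ≤ n := by exact_mod_cast hn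
  obtain ⟨e, he, hdir⟩ := exists_direction hn hs hP
  have hlt := norm_lt_one hn hP
  set c : ℝ := inner ℝ e P.1 with hc
  have hee : ∑ i, e i * e i = 1 := by rw [← norm_sq_eq_sum, he]; norm_num
  have hcabs : |c| ≤ 1 := by
    refine (abs_real_inner_le_norm _ _).trans ?_
    rw [he, one_mul]
    nlinarith [norm_nonneg P.1]
  have horth : inner ℝ e (P.1 - c • e) = (0 : ℝ) := by
    rw [inner_sub_right, inner_smul_right, real_inner_self_eq_norm_sq, he]
    simp [hc]
  refine ⟨e, P.1 - c • e, he, horth, fun θ hθ x hx => ?_⟩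
  set τ : ℝ := θ * ((1 - ‖P.1‖ ^ 2) / (4 * n)) with hτ
  have hstr : stress (P + τ • waveDirection e (P.1 - c • e))
      = stress P - (2 * τ * c + τ ^ 2) • Matrix.vecMulVec e.ofLp e.ofLp := by
    have htr : fluxTrace (P + τ • waveDirection e (P.1 - c • e)) = fluxTrace P := by
      have h0 : ∑ i, e i * (P.1 - c • e) i = 0 := by
        rw [← horth]
        simp [PiLp.inner_apply, mul_comm]
      simp only [fluxTrace, waveDirection, Prod.snd_add, Prod.smul_snd, Pi.add_apply,
        Pi.smul_apply, smul_eq_mul, Finset.sum_add_distrib, ← Finset.mul_sum]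
      rw [h0]
      simp only [mul_comm _ (e _), h0]
      ring
    ext i j
    rw [Matrix.sub_apply, Matrix.smul_apply, stress_apply, stress_apply, htr]
    simp only [waveDirection, Prod.snd_add, Prod.smul_snd, Prod.fst_add, Prod.smul_fst,
      Pi.add_apply, Pi.smul_apply, smul_eq_mul, PiLp.add_apply, PiLp.smul_apply,
      PiLp.sub_apply, Matrix.vecMulVec_apply]
    ring
  have hform : x ⬝ᵥ ((stress P - (2 * τ * c + τ ^ 2) • Matrix.vecMulVec e.ofLp e.ofLp) *ᵥ x)
      = x ⬝ᵥ (stress P *ᵥ x) - (2 * τ * c + τ ^ 2) * (x ⬝ᵥ e.ofLp) ^ 2 := by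
    rw [Matrix.sub_mulVec, Matrix.smul_mulVec, dotProduct_sub, dotProduct_smul,
      Matrix.vecMulVec_mulVec]
    simp only [dotProduct_smul, smul_eq_mul, MulOpposite.smul_eq_mul_unop, MulOpposite.unop_op]
    rw [dotProduct_comm e.ofLp x]
    ring
  rw [hstr, hform]
  have hx1 := hdir x
  have hx0 := hP x hx
  set δ := (1 - ‖P.1‖ ^ 2) / (n : ℝ) with hδ
  have hδ0 : 0 < δ := div_pos (by linarith) (by linarith)
  have hδ1 : δ ≤ 1 := by
    rw [hδ, div_le_one (by linarith)]
    nlinarith [sq_nonneg ‖P.1‖]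
  have hτδ : τ = θ * (δ / 4) := by rw [hτ, hδ]; field_simp
  have hτa : |τ| ≤ δ / 4 := by
    rw [hτδ, abs_mul, abs_of_pos (by positivity : 0 < δ / 4)]
    have := abs_le.2 hθ
    nlinarith
  have hcoef : 2 * τ * c + τ ^ 2 ≤ 3 / 4 * δ := by
    have h1 : τ * c ≤ |τ| * 1 := by
      refine (le_abs_self _).trans ?_
      rw [abs_mul]
      exact mul_le_mul_of_nonneg_left hcabs (abs_nonneg _)
    have h2 : τ ^ 2 ≤ δ / 4 := by
      rw [← sq_abs]
      nlinarith [abs_nonneg τ]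
    linarith
  have h3 : (2 * τ * c + τ ^ 2) * (x ⬝ᵥ e.ofLp) ^ 2 ≤ 3 / 4 * δ * (x ⬝ᵥ e.ofLp) ^ 2 :=
    mul_le_mul_of_nonneg_right hcoef (sq_nonneg _)
  linarith

end StressAlgebra

/-- Smooth compactly supported solutions `(v, M)` of the linear system
`∂ₜv + div M = 0`, `div v = 0`, with symmetric flux `M`. -/
structure IsLinearSolution {n : ℕ} (F : SpaceTime n → State n) : Prop where
  smooth : ContDiff ℝ ∞ F
  compact : HasCompactSupport F
  symm : ∀ z i j, (F z).2 i j = (F z).2 j i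
  incompressible : ∀ z, ∑ j, dx j (fun y => (F y).1 j) z = 0
  momentum : ∀ z i, dt (fun y => (F y).1 i) z + ∑ j, dx j (fun y => (F y).2 i j) z = 0

section LinearSystem

variable {n : ℕ} {F G : SpaceTime n → State n}

theorem dx_eq_dirDeriv (j : Fin n) (f : SpaceTime n → ℝ) (z : SpaceTime n) :
    dx j f z = dirDeriv (EuclideanSpace.single j 1, 0) f z := rfl

theorem dt_eq_dirDeriv (f : SpaceTime n → ℝ) (z : SpaceTime n) :
    dt f z = dirDeriv (0, 1) f z := rfl

theorem contDiff_velocity (hF : ContDiff ℝ ∞ F) (i : Fin n) :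
    ContDiff ℝ ∞ (fun y => (F y).1 i) :=
  contDiff_euclidean.1 (contDiff_fst.comp hF) i

theorem contDiff_flux (hF : ContDiff ℝ ∞ F) (i j : Fin n) :
    ContDiff ℝ ∞ (fun y => (F y).2 i j) :=
  contDiff_pi.1 (contDiff_pi.1 (contDiff_snd.comp hF) i) j

theorem hasCompactSupport_velocity (hF : HasCompactSupport F) (i : Fin n) :
    HasCompactSupport (fun y => (F y).1 i) :=
  hF.comp_left (g := fun P : State n => P.1 i) rfl

theorem hasCompactSupport_flux (hF : HasCompactSupport F) (i j : Fin n) :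
    HasCompactSupport (fun y => (F y).2 i j) :=
  hF.comp_left (g := fun P : State n => P.2 i j) rfl

theorem IsLinearSolution.zero : IsLinearSolution (0 : SpaceTime n → State n) where
  smooth := contDiff_const
  compact := HasCompactSupport.zero
  symm _ _ _ := rfl
  incompressible z := by simp [dx]
  momentum z i := by simp [dx, dt]

theorem IsLinearSolution.add (hF : IsLinearSolution F) (hG : IsLinearSolution G) :
    IsLinearSolution (F + G) where
  smooth := hF.smooth.add hG.smooth
  compact := hF.compact.add hG.compact
  symm z i j := by
    simp only [Pi.add_apply, Prod.snd_add, hF.symm z i j, hG.symm z i j]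
  incompressible z := by
    simp only [Pi.add_apply, Prod.fst_add, PiLp.add_apply, dx_eq_dirDeriv]
    simp only [dirDeriv_add (contDiff_velocity hF.smooth _) (contDiff_velocity hG.smooth _),
      Finset.sum_add_distrib]
    have h1 := hF.incompressible z
    have h2 := hG.incompressible z
    simp only [dx_eq_dirDeriv] at h1 h2
    rw [h1, h2, add_zero]
  momentum z i := by
    simp only [Pi.add_apply, Prod.fst_add, Prod.snd_add, PiLp.add_apply, dx_eq_dirDeriv,
      dt_eq_dirDeriv]
    simp only [dirDeriv_add (contDiff_velocity hF.smooth _) (contDiff_velocity hG.smooth _),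
      dirDeriv_add (contDiff_flux hF.smooth _ _) (contDiff_flux hG.smooth _ _),
      Finset.sum_add_distrib]
    have h1 := hF.momentum z i
    have h2 := hG.momentum z i
    simp only [dx_eq_dirDeriv, dt_eq_dirDeriv] at h1 h2
    linarith

theorem IsLinearSolution.sum {ι : Type*} (s : Finset ι) {H : ι → SpaceTime n → State n}
    (hH : ∀ i ∈ s, IsLinearSolution (H i)) : IsLinearSolution (∑ i ∈ s, H i) :=
  Finset.sum_induction _ _ (fun _ _ => IsLinearSolution.add) IsLinearSolution.zero hH

theorem sum_mul_dx (a : Space n) (f : SpaceTime n → ℝ) (z : SpaceTime n) :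
    ∑ j, a j * dx j f z = dirDeriv (a, 0) f z := by
  have h : (a, (0 : ℝ)) = ∑ j, a j • ((EuclideanSpace.single j 1 : Space n), (0 : ℝ)) := by
    ext i
    · simp [Prod.fst_sum, Finset.sum_apply, Pi.single_apply]
    · simp [Prod.snd_sum]
  rw [h]
  simp [dirDeriv, dx, map_sum, -Prod.smul_mk]

/-- The wave generated by the potential `φ`: a solution of the linear system whose leading part,
for a plane wave `φ = h (η · z)` with `η ⊥ (e, 0)`, `η ⊥ (u, 1)` and `η · (ξ, 0) = 1`,
is `h''` times `waveDirection e u`. -/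
def wave (e ξ u : Space n) (φ : SpaceTime n → ℝ) (z : SpaceTime n) : State n :=
  (WithLp.toLp 2 fun i => e i * dirDeriv (ξ, 0) (dirDeriv (ξ, 0) φ) z
      + -ξ i * dirDeriv (e, 0) (dirDeriv (ξ, 0) φ) z,
    fun i j => (e i * u j + u i * e j) * dirDeriv (ξ, 0) (dirDeriv (ξ, 0) φ) z
      + -(ξ i * u j + u i * ξ j) * dirDeriv (e, 0) (dirDeriv (ξ, 0) φ) z
      + (-(e i * ξ j + ξ i * e j) * dirDeriv (ξ, 0) (dirDeriv (u, 1) φ) z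
      + (2 * ξ i * ξ j) * dirDeriv (e, 0) (dirDeriv (u, 1) φ) z))

theorem wave_eq_zero (e ξ u : Space n) {φ : SpaceTime n → ℝ} {z : SpaceTime n}
    (hz : z ∉ tsupport φ) : wave e ξ u φ z = 0 := by
  have h : ∀ w w', dirDeriv w (dirDeriv w' φ) z = 0 := fun w w' =>
    dirDeriv_eq_zero _ fun h => hz (tsupport_dirDeriv_subset _ _ h)
  simp only [wave, h, mul_zero, add_zero]
  rfl

theorem isLinearSolution_wave (e ξ u : Space n) {φ : SpaceTime n → ℝ} (hφ : ContDiff ℝ ∞ φ)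
    (hc : HasCompactSupport φ) : IsLinearSolution (wave e ξ u φ) := by
  have hsm : ∀ w w', ContDiff ℝ ∞ (dirDeriv w (dirDeriv w' φ)) := fun w w' =>
    contDiff_dirDeriv (contDiff_dirDeriv hφ w') w
  have hm : ∀ (c : ℝ) w w', ContDiff ℝ ∞ (fun z => c * dirDeriv w (dirDeriv w' φ) z) :=
    fun c w w' => contDiff_const.mul (hsm w w')
  have hcomm1 : dirDeriv (e, 0) (dirDeriv (ξ, 0) (dirDeriv (ξ, 0) φ))
      = dirDeriv (ξ, 0) (dirDeriv (e, 0) (dirDeriv (ξ, 0) φ)) :=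
    dirDeriv_comm (contDiff_dirDeriv hφ _) _ _
  have hcomm2 : dirDeriv (e, 0) (dirDeriv (ξ, 0) (dirDeriv (u, 1) φ))
      = dirDeriv (ξ, 0) (dirDeriv (e, 0) (dirDeriv (u, 1) φ)) :=
    dirDeriv_comm (contDiff_dirDeriv hφ _) _ _
  have hcomm3 : ∀ a : SpaceTime n, dirDeriv (ξ, 0) (dirDeriv a (dirDeriv (u, 1) φ))
      = dirDeriv (u, 1) (dirDeriv a (dirDeriv (ξ, 0) φ)) := fun a => by
    rw [dirDeriv_comm hφ a, dirDeriv_comm (contDiff_dirDeriv hφ _) _ (u, 1),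
      dirDeriv_comm hφ (ξ, 0)]
  have hsplit : ∀ f z, dirDeriv ((u, 1) : SpaceTime n) f z
      = dirDeriv (u, 0) f z + dirDeriv (0, 1) f z := fun f z => by
    rw [← dirDeriv_add_left]; simp
  refine ⟨?_, ?_, ?_, ?_, ?_⟩
  · refine ContDiff.prodMk (contDiff_euclidean.2 fun i => ?_)
      (contDiff_pi.2 fun i => contDiff_pi.2 fun j => ?_)
    · exact (hm _ _ _).add (hm _ _ _)
    · exact ((hm _ _ _).add (hm _ _ _)).add ((hm _ _ _).add (hm _ _ _))
  · exact HasCompactSupport.intro hc fun z hz => wave_eq_zero e ξ u hz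
  · intro z i j
    simp only [wave]
    ring
  · intro z
    simp only [wave, dx_eq_dirDeriv]
    simp only [dirDeriv_add (hm _ _ _) (hm _ _ _), dirDeriv_const_mul (hsm _ _)]
    simp only [← dx_eq_dirDeriv, neg_mul, Finset.sum_add_distrib, Finset.sum_neg_distrib,
      sum_mul_dx]
    rw [hcomm1]
    ring
  · intro z i
    simp only [wave, dx_eq_dirDeriv, dt_eq_dirDeriv]
    simp only [dirDeriv_add ((hm _ _ _).add (hm _ _ _)) ((hm _ _ _).add (hm _ _ _)),
      dirDeriv_add (hm _ _ _) (hm _ _ _), dirDeriv_const_mul (hsm _ _)]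
    simp only [← dx_eq_dirDeriv]
    set A := dirDeriv ((ξ, 0) : SpaceTime n) (dirDeriv (ξ, 0) φ) with hA
    set B := dirDeriv ((e, 0) : SpaceTime n) (dirDeriv (ξ, 0) φ) with hB
    set C := dirDeriv ((ξ, 0) : SpaceTime n) (dirDeriv (u, 1) φ) with hC
    set G := dirDeriv ((e, 0) : SpaceTime n) (dirDeriv (u, 1) φ) with hG
    have hsum : ∑ j, ((e i * u j + u i * e j) * dx j A z + -(ξ i * u j + u i * ξ j) * dx j B z
          + (-(e i * ξ j + ξ i * e j) * dx j C z + 2 * ξ i * ξ j * dx j G z))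
        = e i * (dirDeriv (u, 0) A z - dirDeriv (ξ, 0) C z)
          + u i * (dirDeriv (e, 0) A z - dirDeriv (ξ, 0) B z)
          - ξ i * (dirDeriv (u, 0) B z + dirDeriv (e, 0) C z - 2 * dirDeriv (ξ, 0) G z) := by
      simp only [← sum_mul_dx, Finset.mul_sum, ← Finset.sum_sub_distrib,
        ← Finset.sum_add_distrib]
      exact Finset.sum_congr rfl fun j _ => by ring
    rw [hsum, hcomm1, hcomm2, hC, hcomm3, hsplit, hG, hcomm3, hsplit]
    ring

end LinearSystem

section LocalWave

theorem abs_integral_mul_cos_le {E : Type*} [NormedAddCommGroup E] [NormedSpace ℝ E]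
    [FiniteDimensional ℝ E] [MeasurableSpace E] [BorelSpace E] (μ : Measure E)
    [μ.IsAddHaarMeasure] {a : E → ℝ} (ha : ContDiff ℝ ∞ a) (hc : HasCompactSupport a)
    (η : E →L[ℝ] ℝ) {w : E} (hw : η w = 1) {N : ℝ} (hN : 0 < N) :
    |∫ z, a z * Real.cos (N * η z) ∂μ| ≤ (∫ z, |dirDeriv w a z| ∂μ) / N := by
  have hcs : ContDiff ℝ ∞ (fun z => Real.cos (N * η z)) :=
    Real.contDiff_cos.comp (contDiff_const.mul η.contDiff)
  have hs : ContDiff ℝ ∞ (fun z => Real.sin (N * η z)) :=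
    Real.contDiff_sin.comp (contDiff_const.mul η.contDiff)
  have ha' := contDiff_dirDeriv ha w
  have hac' := hasCompactSupport_dirDeriv hc w
  have i1 : Integrable (fun z => dirDeriv w a z * Real.sin (N * η z)) μ :=
    (ha'.mul hs).continuous.integrable_of_hasCompactSupport hac'.mul_right
  have i2 : Integrable (fun z => a z * Real.cos (N * η z)) μ :=
    (ha.mul hcs).continuous.integrable_of_hasCompactSupport hc.mul_right
  have h0 := integral_dirDeriv μ (ha.mul hs) hc.mul_right w
  simp only [dirDeriv_mul_sin ha, hw, mul_one, mul_assoc] at h0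
  rw [integral_add i1 (i2.const_mul N), integral_const_mul] at h0
  have h1 : ∫ z, a z * Real.cos (N * η z) ∂μ
      = -(∫ z, dirDeriv w a z * Real.sin (N * η z) ∂μ) / N := by
    field_simp
    linarith
  rw [h1, abs_div, abs_neg, abs_of_pos hN]
  gcongr
  refine abs_integral_le_integral_abs.trans (integral_mono i1.abs ?_ fun z => ?_)
  · exact (ha'.continuous.integrable_of_hasCompactSupport hac').abs
  · simp only [abs_mul]
    exact mul_le_of_le_one_right (abs_nonneg _) (Real.abs_sin_le_one _)

variable {n : ℕ}

theorem fluxTrace_add (P Q : State n) : fluxTrace (P + Q) = fluxTrace P + fluxTrace Q := by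
  simp [fluxTrace, Finset.sum_add_distrib]

theorem fluxTrace_smul (c : ℝ) (P : State n) : fluxTrace (c • P) = c * fluxTrace P := by
  simp [fluxTrace, Finset.mul_sum]

theorem abs_fluxTrace_le (P : State n) : |fluxTrace P| ≤ n * ‖P‖ := by
  have h : ∀ k ∈ Finset.univ, |P.2 k k| ≤ ‖P‖ := fun k _ =>
    ((norm_le_pi_norm (P.2 k) k).trans (norm_le_pi_norm P.2 k)).trans (norm_snd_le P)
  refine (Finset.abs_sum_le_sum_abs _ _).trans ((Finset.sum_le_sum h).trans ?_)
  simp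

theorem fluxTrace_waveDirection {e u : Space n} (h : inner ℝ e u = (0 : ℝ)) :
    fluxTrace (waveDirection e u) = 0 := by
  have h0 : ∑ i, e i * u i = 0 := by
    rw [← h]
    simp [PiLp.inner_apply, mul_comm]
  simp only [fluxTrace, waveDirection, Finset.sum_add_distrib, mul_comm (u _), h0, add_zero]

/-- The phase `ξ · x - (ξ · u) t`. -/
def phase (ξ u : Space n) : SpaceTime n →L[ℝ] ℝ :=
  (innerSL ℝ ξ).comp (ContinuousLinearMap.fst ℝ (Space n) ℝ)
    - (inner ℝ ξ u : ℝ) • ContinuousLinearMap.snd ℝ (Space n) ℝ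

theorem phase_apply (ξ u : Space n) (x : Space n) (t : ℝ) :
    phase ξ u (x, t) = inner ℝ ξ x - inner ℝ ξ u * t := by
  simp [phase]

theorem exists_wave_bound {e ξ : Space n} (u : Space n) (hξ : ‖ξ‖ = 1)
    (heξ : inner ℝ ξ e = (0 : ℝ)) {χ : SpaceTime n → ℝ} (hχ : ContDiff ℝ ∞ χ)
    (hχc : HasCompactSupport χ) :
    ∃ C : ℝ, ∀ N : ℝ, 1 ≤ N → ∀ z,
      ‖wave e ξ u (oscillation χ (phase ξ u) N) z
        + (χ z * Real.cos (N * phase ξ u z)) • waveDirection e u‖ ≤ C / N := by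
  set η := phase ξ u with hη
  have h1 : η (ξ, 0) = 1 := by
    rw [hη, phase_apply, real_inner_self_eq_norm_sq, hξ]; norm_num
  have h2 : η (e, 0) = 0 := by rw [hη, phase_apply, heξ]; norm_num
  have h3 : η (u, 1) = 0 := by rw [hη, phase_apply]; ring
  obtain ⟨C₁, b₁⟩ := exists_bound_dirDeriv_dirDeriv_oscillation hχ hχc η (ξ, 0) (ξ, 0)
  obtain ⟨C₂, b₂⟩ := exists_bound_dirDeriv_dirDeriv_oscillation hχ hχc η (e, 0) (ξ, 0)
  obtain ⟨C₃, b₃⟩ := exists_bound_dirDeriv_dirDeriv_oscillation hχ hχc η (ξ, 0) (u, 1)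
  obtain ⟨C₄, b₄⟩ := exists_bound_dirDeriv_dirDeriv_oscillation hχ hχc η (e, 0) (u, 1)
  simp only [h1, h2, h3, mul_one, one_mul, zero_mul, mul_zero, add_zero] at b₁ b₂ b₃ b₄
  let P₂ : State n := (-ξ, fun i j => -(ξ i * u j + u i * ξ j))
  let P₃ : State n := (0, fun i j => -(e i * ξ j + ξ i * e j))
  let P₄ : State n := (0, fun i j => 2 * ξ i * ξ j)
  refine ⟨C₁ * ‖waveDirection e u‖ + C₂ * ‖P₂‖ + C₃ * ‖P₃‖ + C₄ * ‖P₄‖, fun N hN z => ?_⟩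
  have hdec : wave e ξ u (oscillation χ η N) z
        + (χ z * Real.cos (N * η z)) • waveDirection e u
      = (dirDeriv (ξ, 0) (dirDeriv (ξ, 0) (oscillation χ η N)) z + χ z * Real.cos (N * η z))
          • waveDirection e u
        + dirDeriv (e, 0) (dirDeriv (ξ, 0) (oscillation χ η N)) z • P₂
        + dirDeriv (ξ, 0) (dirDeriv (u, 1) (oscillation χ η N)) z • P₃
        + dirDeriv (e, 0) (dirDeriv (u, 1) (oscillation χ η N)) z • P₄ := by
    ext i
    · simp [wave, waveDirection, P₂, P₃, P₄]
      ring
    · simp [wave, waveDirection, P₂, P₃, P₄]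
      ring
  rw [hdec]
  have hb : ∀ (c C : ℝ) (P : State n), |c| ≤ C / N → ‖c • P‖ ≤ C * ‖P‖ / N := by
    intro c C P h
    rw [norm_smul, Real.norm_eq_abs, mul_div_right_comm]
    exact mul_le_mul_of_nonneg_right h (norm_nonneg _)
  calc _ ≤ _ := norm_add_le _ _
    _ ≤ _ := add_le_add_left (norm_add₃_le) _
    _ ≤ C₁ * ‖waveDirection e u‖ / N + C₂ * ‖P₂‖ / N + C₃ * ‖P₃‖ / N + C₄ * ‖P₄‖ / N := by
      gcongr
      · exact hb _ _ _ (b₁ N hN z)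
      · exact hb _ _ _ (b₂ N hN z)
      · exact hb _ _ _ (b₃ N hN z)
      · exact hb _ _ _ (b₄ N hN z)
    _ = _ := by ring

instance isAddHaarMeasure_volume (n : ℕ) : (volume : Measure (SpaceTime n)).IsAddHaarMeasure :=
  inferInstanceAs ((volume : Measure (Space n)).prod (volume : Measure ℝ)).IsAddHaarMeasure

theorem IsLinearSolution.integrable_norm_sq {F : SpaceTime n → State n}
    (hF : IsLinearSolution F) : Integrable (fun z => ‖(F z).1‖ ^ 2) := by
  have h1 : Continuous (fun z => ‖(F z).1‖ ^ 2) :=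
    (continuous_fst.comp hF.smooth.continuous).norm.pow 2
  have h2 : HasCompactSupport (fun z => ‖(F z).1‖ ^ 2) :=
    hF.compact.comp_left (g := fun P : State n => ‖P.1‖ ^ 2) (by simp)
  exact h1.integrable_of_hasCompactSupport h2

theorem exists_wave_energy_bound {e ξ : Space n} (u : Space n) (he : ‖e‖ = 1) (hξ : ‖ξ‖ = 1)
    (heξ : inner ℝ ξ e = (0 : ℝ)) {χ : SpaceTime n → ℝ} (hχ : ContDiff ℝ ∞ χ)
    (hχc : HasCompactSupport χ) :
    ∃ K : ℝ, ∀ N : ℝ, 1 ≤ N →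
      (∫ z, χ z ^ 2) / 2 - K / N
        ≤ ∫ z, ‖(wave e ξ u (oscillation χ (phase ξ u) N) z).1‖ ^ 2 := by
  obtain ⟨C, hC⟩ := exists_wave_bound u hξ heξ hχ hχc
  set η := phase ξ u with hη
  have h1 : η (ξ, 0) = 1 := by
    rw [hη, phase_apply, real_inner_self_eq_norm_sq, hξ]; norm_num
  have hsq : ContDiff ℝ ∞ (fun z => χ z ^ 2) := hχ.pow 2
  have hsqc : HasCompactSupport (fun z => χ z ^ 2) :=
    hχc.comp_left (g := fun x : ℝ => x ^ 2) (by norm_num)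
  have hi2 : Integrable (fun z => χ z ^ 2) := hsq.continuous.integrable_of_hasCompactSupport hsqc
  have hi1 : Integrable (fun z => |χ z|) :=
    (hχ.continuous.integrable_of_hasCompactSupport hχc).abs
  refine ⟨(∫ z, |dirDeriv (ξ, 0) (fun z => χ z ^ 2) z|) / 4 + 2 * C * ∫ z, |χ z|,
    fun N hN => ?_⟩
  have hN0 : 0 < N := by linarith
  have hcos := abs_integral_mul_cos_le volume hsq hsqc η h1 (by positivity : 0 < 2 * N)
  have hic : Integrable (fun z => χ z ^ 2 * Real.cos (2 * N * η z)) := by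
    refine (hsq.continuous.mul ?_).integrable_of_hasCompactSupport hsqc.mul_right
    exact Real.continuous_cos.comp (continuous_const.mul η.continuous)
  have hpt : ∀ z, χ z ^ 2 * (1 / 2) + χ z ^ 2 * Real.cos (2 * N * η z) * (1 / 2)
      - 2 * (C / N) * |χ z| ≤ ‖(wave e ξ u (oscillation χ η N) z).1‖ ^ 2 := by
    intro z
    have hb := (norm_fst_le _).trans (hC N hN z)
    set a : Space n := (wave e ξ u (oscillation χ η N) z).1
    set c : ℝ := χ z * Real.cos (N * η z) with hc
    change ‖a + c • e‖ ≤ _ at hb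
    have hca : |c| ≤ |χ z| := by
      rw [hc, abs_mul]
      exact mul_le_of_le_one_right (abs_nonneg _) (Real.abs_cos_le_one _)
    have hnc : ‖c • e‖ = |c| := by rw [norm_smul, he, mul_one, Real.norm_eq_abs]
    have h4 : |c| - C / N ≤ ‖a‖ := by
      have := norm_sub_le (a + c • e) a
      rw [add_sub_cancel_left, hnc] at this
      linarith
    have hCN : 0 ≤ C / N := (norm_nonneg _).trans hb
    have hc2 : c ^ 2 = χ z ^ 2 * (1 / 2) + χ z ^ 2 * Real.cos (2 * N * η z) * (1 / 2) := by
      rw [hc, mul_pow, Real.cos_sq, ← mul_assoc]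
      ring
    rw [← hc2, ← sq_abs c]
    have h5 : 2 * (C / N) * |c| ≤ 2 * (C / N) * |χ z| := by gcongr
    by_cases h6 : 0 ≤ |c| - C / N
    · nlinarith [norm_nonneg a]
    · nlinarith [norm_nonneg a, abs_nonneg c, sq_nonneg ‖a‖]
  have hw := (isLinearSolution_wave e ξ u (contDiff_oscillation hχ η N)
    (hasCompactSupport_oscillation hχc η N)).integrable_norm_sq
  have hi3 : Integrable (fun z => χ z ^ 2 * (1 / 2)
      + χ z ^ 2 * Real.cos (2 * N * η z) * (1 / 2)) :=
    (hi2.mul_const (1 / 2)).add (hic.mul_const (1 / 2))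
  have hint := integral_mono (hi3.sub (hi1.const_mul (2 * (C / N)))) hw hpt
  simp only [Pi.sub_apply] at hint
  have hsplit : ∫ z, (χ z ^ 2 * (1 / 2) + χ z ^ 2 * Real.cos (2 * N * η z) * (1 / 2)
        - 2 * (C / N) * |χ z|)
      = (∫ z, χ z ^ 2) * (1 / 2) + (∫ z, χ z ^ 2 * Real.cos (2 * N * η z)) * (1 / 2)
        - 2 * (C / N) * ∫ z, |χ z| := by
    rw [integral_sub hi3 (hi1.const_mul (2 * (C / N))), integral_add (hi2.mul_const (1 / 2))
      (hic.mul_const (1 / 2)), integral_mul_const, integral_mul_const, integral_const_mul]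
  refine le_trans ?_ (hsplit.symm.le.trans hint)
  have h7 := (abs_le.1 hcos).1
  have h8 : (∫ z, |dirDeriv (ξ, 0) (fun z => χ z ^ 2) z|) / (2 * N)
      = 2 * ((∫ z, |dirDeriv (ξ, 0) (fun z => χ z ^ 2) z|) / 4 / N) := by
    field_simp
    ring
  have h9 : 2 * C * (∫ z, |χ z|) / N = 2 * (C / N) * ∫ z, |χ z| := by ring
  rw [add_div, h9]
  linarith

theorem tendsto_integral_wave_mul (e ξ u : Space n) {χ ψ : SpaceTime n → ℝ}
    (hχ : ContDiff ℝ ∞ χ) (hχc : HasCompactSupport χ) (hψ : ContDiff ℝ ∞ ψ)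
    (η : SpaceTime n →L[ℝ] ℝ) (i : Fin n) :
    Tendsto (fun k : ℕ => ∫ z, (wave e ξ u (oscillation χ η (k + 1)) z).1 i * ψ z)
      atTop (𝓝 0) := by
  have hA := tendsto_integral_dirDeriv_oscillation_mul volume hχ hχc hψ η (ξ, 0) (ξ, 0)
  have hB := tendsto_integral_dirDeriv_oscillation_mul volume hχ hχc hψ η (e, 0) (ξ, 0)
  have h := (hA.const_mul (e i)).add (hB.const_mul (-ξ i))
  simp only [mul_zero, add_zero] at h
  refine h.congr fun k => ?_
  have hint : ∀ w w', Integrable (fun z : SpaceTime n =>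
      dirDeriv w (dirDeriv w' (oscillation χ η (k + 1))) z * ψ z) := fun w w' =>
    ((contDiff_dirDeriv (contDiff_dirDeriv (contDiff_oscillation hχ η _) _) _).continuous.mul
      hψ.continuous).integrable_of_hasCompactSupport (hasCompactSupport_dirDeriv
        (hasCompactSupport_dirDeriv (hasCompactSupport_oscillation hχc η _) _) _).mul_right
  rw [← integral_const_mul, ← integral_const_mul,
    ← integral_add ((hint _ _).const_mul _) ((hint _ _).const_mul _)]
  congr 1
  funext z
  simp only [wave]
  ring

theorem exists_unit_orthogonal (hn : 2 ≤ n) (e : Space n) :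
    ∃ ξ : Space n, ‖ξ‖ = 1 ∧ inner ℝ ξ e = (0 : ℝ) := by
  have hne : (Submodule.span ℝ {e})ᗮ ≠ ⊥ := by
    intro h
    rw [Submodule.orthogonal_eq_bot_iff] at h
    have h1 := finrank_span_le_card (R := ℝ) ({e} : Set (Space n))
    rw [h, finrank_top, finrank_euclideanSpace, Fintype.card_fin] at h1
    simp at h1
    omega
  obtain ⟨x, hx, hx0⟩ := Submodule.exists_mem_ne_zero_of_ne_bot hne
  refine ⟨‖x‖⁻¹ • x, ?_, ?_⟩
  · rw [norm_smul, norm_inv, norm_norm, inv_mul_cancel₀ (norm_ne_zero_iff.2 hx0)]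
  · rw [inner_smul_left, Submodule.mem_orthogonal_singleton_iff_inner_left.1 hx, mul_zero]

end LocalWave

/-- The fraction of the squared energy defect that a perturbation on a ball gains. -/
def gainConst (n : ℕ) : ℝ := 2⁻¹ ^ Module.finrank ℝ (SpaceTime n) / (256 * (n : ℝ) ^ 2)

/-- The squared energy defect `(1 - |v|²)²` of a state. -/
def defectSq {n : ℕ} (P : State n) : ℝ := (1 - ‖P.1‖ ^ 2) ^ 2

section Perturbation

variable {n : ℕ}

theorem continuous_defectSq : Continuous (defectSq (n := n)) := by
  unfold defectSq
  fun_prop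

theorem gainConst_pos (hn : 0 < n) : 0 < gainConst n := by
  have : (0 : ℝ) < n := by exact_mod_cast hn
  unfold gainConst
  positivity

/-- `w` is a sequence of high-frequency perturbations of `F` supported in `S`, gaining at least
the energy `g`. -/
structure IsPerturbation (F : SpaceTime n → State n) (S : Set (SpaceTime n)) (g : ℝ)
    (w : ℕ → SpaceTime n → State n) : Prop where
  linear : ∀ k, IsLinearSolution (w k)
  eq_zero : ∀ k z, z ∉ S → w k z = 0
  mem : ∀ᶠ k in atTop, ∀ z ∈ S, F z + w k z ∈ relaxedSet n
  gain : ∀ᶠ k in atTop, g ≤ ∫ z, ‖(w k z).1‖ ^ 2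
  trace : ∀ ε > 0, ∀ᶠ k in atTop, ∀ z, |fluxTrace (w k z)| ≤ ε
  weak : ∀ ψ : SpaceTime n → ℝ, ContDiff ℝ ∞ ψ → ∀ i,
    Tendsto (fun k => ∫ z, (w k z).1 i * ψ z) atTop (𝓝 0)

theorem tendsto_const_div_add_one (C : ℝ) :
    Tendsto (fun k : ℕ => C / ((k : ℝ) + 1)) atTop (𝓝 0) := by
  have h := (tendsto_one_div_add_atTop_nhds_zero_nat (𝕜 := ℝ)).const_mul C
  simpa [mul_one_div, div_eq_mul_inv] using h

theorem exists_local_perturbation (hn : 2 ≤ n) {F : SpaceTime n → State n}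
    (hF : IsLinearSolution F) (hU : ∀ z, F z ∈ relaxedSet n) (z₀ : SpaceTime n) :
    ∃ ρ > 0, ∀ r ∈ Set.Ioo 0 ρ, ∃ w, IsPerturbation F (Metric.closedBall z₀ r)
      (gainConst n * ∫ z in Metric.closedBall z₀ r, defectSq (F z)) w := by
  have hn0 : 0 < n := by omega
  have hnR : (0 : ℝ) < n := by exact_mod_cast hn0
  obtain ⟨e, u, he, heu, hseg⟩ := exists_wave_segment hn0 (hF.symm z₀) (hU z₀)
  obtain ⟨ξ, hξ, hξe⟩ := exists_unit_orthogonal hn e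
  set δ : ℝ := 1 - ‖(F z₀).1‖ ^ 2 with hδ
  have hδ0 : 0 < δ := by have := norm_lt_one hn0 (hU z₀); linarith
  set s : ℝ := δ / (4 * n) with hs
  have hs0 : 0 < s := by positivity
  have hScompact : IsCompact ((fun θ : ℝ => F z₀ + (θ * s) • waveDirection e u) ''
      Set.Icc (-1) 1) := by
    apply isCompact_Icc.image
    fun_prop
  obtain ⟨ε, hε, hthick⟩ := hScompact.exists_thickening_subset_open (isOpen_relaxedSet n)
    (by rintro _ ⟨θ, hθ, rfl⟩; exact hseg θ hθ)
  have hcF := hF.smooth.continuous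
  have hev : ∀ᶠ z in 𝓝 z₀, dist (F z) (F z₀) < ε / 2 ∧ defectSq (F z) < (2 * δ) ^ 2 := by
    refine (Metric.tendsto_nhds.1 hcF.continuousAt _ (half_pos hε)).and ?_
    apply (continuous_defectSq.comp hcF).continuousAt.eventually_lt_const
    change δ ^ 2 < _
    nlinarith
  obtain ⟨ρ, hρ, hball⟩ := Metric.eventually_nhds_iff.1 hev
  refine ⟨ρ, hρ, fun r hr => ?_⟩
  have hr0 : 0 < r := hr.1
  let b : ContDiffBump z₀ := ⟨r / 2, r, half_pos hr0, half_lt_self hr0⟩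
  let χ : SpaceTime n → ℝ := fun z => s * b z
  have hχ : ContDiff ℝ ∞ χ := contDiff_const.mul b.contDiff
  have hχc : HasCompactSupport χ := b.hasCompactSupport.mul_left
  have hχt : tsupport χ ⊆ Metric.closedBall z₀ r := by
    refine (tsupport_mul_subset_right (f := fun _ => s) (g := b)).trans ?_
    rw [b.tsupport_eq]
  set η := phase ξ u with hη
  obtain ⟨C, hC⟩ := exists_wave_bound u hξ hξe hχ hχc
  obtain ⟨K, hK⟩ := exists_wave_energy_bound u he hξ hξe hχ hχc
  have hN : ∀ k : ℕ, (1 : ℝ) ≤ (k : ℝ) + 1 := fun k => by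
    have : (0 : ℝ) ≤ k := Nat.cast_nonneg k
    linarith
  refine ⟨fun k => wave e ξ u (oscillation χ η (k + 1)), ⟨fun k => ?_, ?_, ?_, ?_, ?_, ?_⟩⟩
  · exact isLinearSolution_wave e ξ u (contDiff_oscillation hχ η _)
      (hasCompactSupport_oscillation hχc η _)
  · intro k z hz
    exact wave_eq_zero e ξ u fun h => hz (hχt (tsupport_oscillation_subset _ _ _ h))
  · filter_upwards [(tendsto_const_div_add_one C).eventually_lt_const (half_pos hε)] with k hk z hz
    apply hthick
    rw [Metric.mem_thickening_iff]
    refine ⟨F z₀ + ((-(b z * Real.cos (((k : ℝ) + 1) * η z))) * s) • waveDirection e u,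
      ⟨_, ?_, rfl⟩, ?_⟩
    · rw [Set.mem_Icc, ← abs_le, abs_neg, abs_mul, abs_of_nonneg b.nonneg]
      exact mul_le_one₀ b.le_one (abs_nonneg _) (Real.abs_cos_le_one _)
    · have h1 := (hball (lt_of_le_of_lt (Metric.mem_closedBall.1 hz) hr.2)).1
      have h2 := (hC _ (hN k) z).trans_lt hk
      rw [dist_eq_norm] at h1 ⊢
      have h3 : F z + wave e ξ u (oscillation χ η (k + 1)) z
          - (F z₀ + ((-(b z * Real.cos (((k : ℝ) + 1) * η z))) * s) • waveDirection e u)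
          = (F z - F z₀) + (wave e ξ u (oscillation χ η (k + 1)) z
            + (χ z * Real.cos (((k : ℝ) + 1) * η z)) • waveDirection e u) := by
        have h4 : -(b z * Real.cos (((k : ℝ) + 1) * η z)) * s
            = -(χ z * Real.cos (((k : ℝ) + 1) * η z)) := by simp only [χ]; ring
        rw [h4, neg_smul]
        abel
      rw [h3]
      refine (norm_add_le _ _).trans_lt ?_
      linarith
  · have hfin : ∀ ρ' : ℝ, volume (Metric.closedBall z₀ ρ') ≠ ⊤ := fun ρ' =>
      measure_closedBall_lt_top.ne
    have hvol : volume.real (Metric.closedBall z₀ (r / 2))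
        = 2⁻¹ ^ Module.finrank ℝ (SpaceTime n) * volume.real (Metric.closedBall z₀ r) := by
      have h1 := Measure.addHaar_closedBall_mul (volume : Measure (SpaceTime n)) z₀
        (by norm_num : (0 : ℝ) ≤ 2⁻¹) hr0.le
      have h2 := Measure.addHaar_closedBall_center (volume : Measure (SpaceTime n)) z₀ r
      rw [← h2] at h1
      rw [measureReal_def, measureReal_def, show r / 2 = 2⁻¹ * r by ring, h1, ENNReal.toReal_mul,
        ENNReal.toReal_ofReal (by positivity)]
    set V := volume.real (Metric.closedBall z₀ r) with hV
    have hV0 : 0 < V := ENNReal.toReal_pos (Metric.measure_closedBall_pos volume z₀ hr0).ne'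
      (hfin r)
    have hi2 : Integrable (fun z => χ z ^ 2) :=
      (hχ.pow 2).continuous.integrable_of_hasCompactSupport
        (hχc.comp_left (g := fun x : ℝ => x ^ 2) (by norm_num))
    have hlow : s ^ 2 * (2⁻¹ ^ Module.finrank ℝ (SpaceTime n) * V) ≤ ∫ z, χ z ^ 2 := by
      rw [← hvol]
      calc s ^ 2 * volume.real (Metric.closedBall z₀ (r / 2))
          = ∫ z in Metric.closedBall z₀ (r / 2), s ^ 2 := by
            rw [setIntegral_const, smul_eq_mul, mul_comm]
        _ = ∫ z in Metric.closedBall z₀ (r / 2), χ z ^ 2 := by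
            apply setIntegral_congr_fun Metric.isClosed_closedBall.measurableSet
            intro z hz
            have : b z = 1 := b.one_of_mem_closedBall hz
            simp only [χ, this, mul_one]
        _ ≤ ∫ z, χ z ^ 2 :=
            setIntegral_le_integral hi2 (Eventually.of_forall fun z => sq_nonneg _)
    have hup : ∫ z in Metric.closedBall z₀ r, defectSq (F z) ≤ (2 * δ) ^ 2 * V := by
      have h1 : ∫ z in Metric.closedBall z₀ r, defectSq (F z)
          ≤ ∫ z in Metric.closedBall z₀ r, (2 * δ) ^ 2 := by
        apply setIntegral_mono_on
        · exact ((continuous_defectSq.comp hcF).continuousOn).integrableOn_compact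
            (isCompact_closedBall z₀ r)
        · exact integrableOn_const (hfin r)
        · exact Metric.isClosed_closedBall.measurableSet
        · intro z hz
          exact (hball (lt_of_le_of_lt (Metric.mem_closedBall.1 hz) hr.2)).2.le
      rwa [setIntegral_const, smul_eq_mul, mul_comm] at h1
    have hpos : 0 < (∫ z, χ z ^ 2) / 4 := by
      have : 0 < s ^ 2 * (2⁻¹ ^ Module.finrank ℝ (SpaceTime n) * V) := by positivity
      linarith
    filter_upwards [(tendsto_const_div_add_one K).eventually_lt_const hpos] with k hk
    have h1 := hK _ (hN k)
    have h2 : gainConst n * ∫ z in Metric.closedBall z₀ r, defectSq (F z)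
        ≤ gainConst n * ((2 * δ) ^ 2 * V) :=
      mul_le_mul_of_nonneg_left hup (gainConst_pos hn0).le
    have h3 : gainConst n * ((2 * δ) ^ 2 * V)
        = s ^ 2 * (2⁻¹ ^ Module.finrank ℝ (SpaceTime n) * V) / 4 := by
      rw [hs, gainConst]
      field_simp
      ring
    linarith
  · intro ε' hε'
    filter_upwards [(tendsto_const_div_add_one (n * C)).eventually_lt_const hε'] with k hk z
    have h1 := abs_fluxTrace_le (wave e ξ u (oscillation χ η (k + 1)) z
      + (χ z * Real.cos (((k : ℝ) + 1) * η z)) • waveDirection e u)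
    rw [fluxTrace_add, fluxTrace_smul, fluxTrace_waveDirection heu, mul_zero, add_zero] at h1
    have h2 := mul_le_mul_of_nonneg_left (hC _ (hN k) z) hnR.le
    rw [← mul_div_assoc] at h2
    linarith
  · intro ψ hψ i
    exact tendsto_integral_wave_mul e ξ u hχ hχc hψ η i

theorem exists_perturbation (hn : 2 ≤ n) (Ω : TopologicalSpace.Opens (SpaceTime n))
    (hΩ : Bornology.IsBounded (Ω : Set (SpaceTime n))) {F : SpaceTime n → State n}
    (hF : IsLinearSolution F) (hU : ∀ z, F z ∈ relaxedSet n) :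
    ∃ S w, IsCompact S ∧ S ⊆ (Ω : Set (SpaceTime n)) ∧ IsPerturbation F S
      (gainConst n / 2 * ∫ z in (Ω : Set (SpaceTime n)), defectSq (F z)) w := by
  have hn0 : 0 < n := by omega
  have hloc : ∀ x : SpaceTime n, ∃ ρ > 0, x ∈ Ω → ∀ r ∈ Set.Ioo 0 ρ,
      Metric.closedBall x r ⊆ (Ω : Set (SpaceTime n)) ∧
      ∃ w, IsPerturbation F (Metric.closedBall x r)
        (gainConst n * ∫ z in Metric.closedBall x r, defectSq (F z)) w := by
    intro x
    by_cases hx : x ∈ Ω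
    · obtain ⟨ρ₁, hρ₁, h₁⟩ := exists_local_perturbation hn hF hU x
      obtain ⟨ρ₂, hρ₂, h₂⟩ := Metric.nhds_basis_closedBall.mem_iff.1 (Ω.isOpen.mem_nhds hx)
      refine ⟨min ρ₁ ρ₂, lt_min hρ₁ hρ₂, fun _ r hr => ⟨?_, ?_⟩⟩
      · exact (Metric.closedBall_subset_closedBall (hr.2.le.trans (min_le_right _ _))).trans h₂
      · exact h₁ r ⟨hr.1, hr.2.trans_le (min_le_left _ _)⟩
    · exact ⟨1, one_pos, fun h => absurd h hx⟩
  choose ρ hρ hloc using hloc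
  obtain ⟨t, r, htc, htΩ, htr, hcover, hdisj⟩ := Besicovitch.exists_disjoint_closedBall_covering_ae
    (volume : Measure (SpaceTime n)) (fun _ => Set.univ) (Ω : Set (SpaceTime n))
    (fun x _ δ hδ => ⟨δ / 2, Set.mem_univ _, half_pos hδ, half_lt_self hδ⟩) ρ (fun x _ => hρ x)
  have hballs : ∀ x : t, Metric.closedBall (x : SpaceTime n) (r x) ⊆ (Ω : Set (SpaceTime n)) :=
    fun x => (hloc x (htΩ x.2) _ (htr x x.2).2).1
  have hw : ∀ x : t, ∃ w, IsPerturbation F (Metric.closedBall (x : SpaceTime n) (r x))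
      (gainConst n * ∫ z in Metric.closedBall (x : SpaceTime n) (r x), defectSq (F z)) w :=
    fun x => (hloc x (htΩ x.2) _ (htr x x.2).2).2
  choose w hw using hw
  have hpd : Pairwise (Function.onFun Disjoint
      fun x : t => Metric.closedBall (x : SpaceTime n) (r x)) := fun x y hxy =>
    hdisj x.2 y.2 fun h => hxy (Subtype.ext h)
  have hcd : Continuous fun z => defectSq (F z) :=
    continuous_defectSq.comp hF.smooth.continuous
  have hIΩ : IntegrableOn (fun z => defectSq (F z)) (Ω : Set (SpaceTime n)) volume :=
    (hcd.continuousOn.integrableOn_compact hΩ.isCompact_closure).mono_set subset_closure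
  have : Countable t := htc.to_subtype
  have hUn : (⋃ x : t, Metric.closedBall (x : SpaceTime n) (r x)) ⊆ (Ω : Set (SpaceTime n)) :=
    Set.iUnion_subset hballs
  have hsum := hasSum_integral_iUnion (μ := volume) (f := fun z => defectSq (F z))
    (fun x : t => (Metric.isClosed_closedBall (x := (x : SpaceTime n))
      (ε := r x)).measurableSet) hpd (hIΩ.mono_set hUn)
  have hEq : ∫ z in ⋃ x : t, Metric.closedBall (x : SpaceTime n) (r x), defectSq (F z)
      = ∫ z in (Ω : Set (SpaceTime n)), defectSq (F z) := by
    apply setIntegral_congr_set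
    refine (LE.le.eventuallyLE hUn).antisymm ?_
    rw [ae_le_set]
    rwa [Set.biUnion_eq_iUnion] at hcover
  rw [hEq] at hsum
  set I := ∫ z in (Ω : Set (SpaceTime n)), defectSq (F z) with hI
  have hI0 : 0 ≤ I := integral_nonneg fun z => sq_nonneg _
  obtain ⟨s, hs⟩ : ∃ s : Finset t,
      I / 2 ≤ ∑ x ∈ s, ∫ z in Metric.closedBall (x : SpaceTime n) (r x), defectSq (F z) := by
    rcases hI0.eq_or_lt with h | h
    · exact ⟨∅, by simp [← h]⟩
    · exact ((hsum.eventually_const_lt (half_lt_self h)).exists).imp fun s hs => hs.le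
  have hdich : ∀ k z, (∑ x ∈ s, w x k) z = 0 ∧ (∀ x ∈ s, w x k z = 0) ∨
      ∃ x ∈ s, z ∈ Metric.closedBall (x : SpaceTime n) (r x) ∧
        (∑ x ∈ s, w x k) z = w x k z ∧ ∀ y ∈ s, y ≠ x → w y k z = 0 := by
    intro k z
    simp only [Finset.sum_apply]
    by_cases h : ∃ x ∈ s, z ∈ Metric.closedBall (x : SpaceTime n) (r x)
    · obtain ⟨x, hx, hz⟩ := h
      have h0 : ∀ y ∈ s, y ≠ x → w y k z = 0 := fun y _ hyx =>
        (hw y).eq_zero k z fun hzy => Set.disjoint_left.1 (hpd hyx) hzy hz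
      exact Or.inr ⟨x, hx, hz, Finset.sum_eq_single_of_mem x hx h0, h0⟩
    · push Not at h
      have h0 : ∀ y ∈ s, w y k z = 0 := fun y hy => (hw y).eq_zero k z (h y hy)
      exact Or.inl ⟨Finset.sum_eq_zero h0, h0⟩
  refine ⟨⋃ x ∈ s, Metric.closedBall (x : SpaceTime n) (r x), fun k => ∑ x ∈ s, w x k,
    s.isCompact_biUnion fun x _ => isCompact_closedBall _ _, Set.iUnion₂_subset fun x _ => hballs x,
    ⟨fun k => ?_, ?_, ?_, ?_, ?_, ?_⟩⟩
  · exact IsLinearSolution.sum s fun x _ => (hw x).linear k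
  · intro k z hz
    rw [Finset.sum_apply]
    exact Finset.sum_eq_zero fun x hx => (hw x).eq_zero k z fun h =>
      hz (Set.mem_iUnion₂.2 ⟨x, hx, h⟩)
  · filter_upwards [(Finset.eventually_all s).2 fun x _ => (hw x).mem] with k hk z _
    rcases hdich k z with ⟨h, -⟩ | ⟨x, hx, hz, h, -⟩
    · rw [h, add_zero]
      exact hU z
    · rw [h]
      exact hk x hx z hz
  · filter_upwards [(Finset.eventually_all s).2 fun x _ => (hw x).gain] with k hk
    have hpt : (fun z => ‖((∑ x ∈ s, w x k) z).1‖ ^ 2)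
        = fun z => ∑ x ∈ s, ‖(w x k z).1‖ ^ 2 := by
      funext z
      rcases hdich k z with ⟨h, h0⟩ | ⟨x, hx, -, h, h0⟩
      · rw [h, Finset.sum_eq_zero fun x hx => by rw [h0 x hx]; simp]
        simp
      · rw [h, Finset.sum_eq_single_of_mem x hx fun y hy hyx => by rw [h0 y hy hyx]; simp]
    rw [hpt, integral_finsetSum _ fun x _ => ((hw x).linear k).integrable_norm_sq]
    refine le_trans ?_ (Finset.sum_le_sum hk)
    rw [← Finset.mul_sum, div_mul_eq_mul_div, mul_div_assoc]
    exact mul_le_mul_of_nonneg_left hs (gainConst_pos hn0).le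
  · intro ε hε
    filter_upwards [(Finset.eventually_all s).2 fun x _ => (hw x).trace ε hε] with k hk z
    rcases hdich k z with ⟨h, -⟩ | ⟨x, hx, -, h, -⟩
    · rw [h]
      simpa [fluxTrace] using hε.le
    · rw [h]
      exact hk x hx z
  · intro ψ hψ i
    have h := tendsto_finsetSum s fun x _ => (hw x).weak ψ hψ i
    rw [Finset.sum_const_zero] at h
    refine h.congr fun k => ?_
    rw [← integral_finsetSum]
    · congr 1
      funext z
      simp only [Finset.sum_apply, Prod.fst_sum, WithLp.ofLp_sum, Finset.sum_mul]
    · intro x _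
      exact ((contDiff_velocity ((hw x).linear k).smooth i).continuous.mul
        hψ.continuous).integrable_of_hasCompactSupport
        (hasCompactSupport_velocity ((hw x).linear k).compact i).mul_right

end Perturbation

/-- A subsolution: a compactly supported solution of the linear system in `Ω` with positive
definite Reynolds stress. -/
structure IsSubsolution {n : ℕ} (Ω : TopologicalSpace.Opens (SpaceTime n))
    (F : SpaceTime n → State n) : Prop extends IsLinearSolution F where
  tsupport_subset : tsupport F ⊆ Ω
  mem : ∀ z, F z ∈ relaxedSet n

section Iteration

variable {n : ℕ} {Ω : TopologicalSpace.Opens (SpaceTime n)}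

theorem isSubsolution_zero (hn : 0 < n) : IsSubsolution Ω (0 : SpaceTime n → State n) := by
  refine ⟨IsLinearSolution.zero, by simp [tsupport_zero], fun z x hx => ?_⟩
  have hs : stress (0 : State n) = (1 / (n : ℝ)) • (1 : Matrix (Fin n) (Fin n) ℝ) := by
    ext i j
    simp [stress_apply, fluxTrace, Matrix.one_apply]
  have hnR : (0 : ℝ) < n := by exact_mod_cast hn
  change 0 < dotProduct x (Matrix.mulVec (stress (0 : State n)) x)
  rw [hs, Matrix.smul_mulVec, Matrix.one_mulVec, dotProduct_smul, smul_eq_mul]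
  have h0 : 0 < dotProduct x x := by
    simpa using Matrix.dotProduct_star_self_pos_iff.2 hx
  positivity

theorem integrable_velocity_mul {F G : SpaceTime n → State n} (hF : IsLinearSolution F)
    (hG : IsLinearSolution G) (i : Fin n) :
    Integrable (fun z => (F z).1 i * (G z).1 i) :=
  ((contDiff_velocity hF.smooth i).continuous.mul
    (contDiff_velocity hG.smooth i).continuous).integrable_of_hasCompactSupport
    (hasCompactSupport_velocity hF.compact i).mul_right

theorem exists_subsolution_step (hn : 2 ≤ n) (hΩ : Bornology.IsBounded (Ω : Set (SpaceTime n)))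
    {F : SpaceTime n → State n} (hF : IsSubsolution Ω F) (T : List (SpaceTime n → State n))
    (hT : ∀ G ∈ T, IsSubsolution Ω G) {ε : ℝ} (hε : 0 < ε) :
    ∃ F', IsSubsolution Ω F' ∧
      gainConst n / 2 * ∫ z in (Ω : Set (SpaceTime n)), defectSq (F z)
        ≤ ∫ z, ‖(F' z).1 - (F z).1‖ ^ 2 ∧
      (∀ z, |fluxTrace (F' z) - fluxTrace (F z)| ≤ ε) ∧
      ∀ G ∈ T, |∫ z, inner ℝ ((F' z).1 - (F z).1) (G z).1| ≤ ε := by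
  obtain ⟨S, w, hS, hSΩ, hw⟩ := exists_perturbation hn Ω hΩ hF.toIsLinearSolution hF.mem
  have hweak : ∀ᶠ k in atTop, ∀ G ∈ T, |∫ z, inner ℝ (w k z).1 (G z).1| ≤ ε := by
    have h : ∀ G ∈ T, ∀ᶠ k in atTop, |∫ z, inner ℝ (w k z).1 (G z).1| ≤ ε := by
      intro G hG
      have h1 := tendsto_finsetSum Finset.univ fun i _ =>
        hw.weak _ (contDiff_velocity (hT G hG).smooth i) i
      rw [Finset.sum_const_zero] at h1
      have h2 := h1.abs
      rw [abs_zero] at h2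
      filter_upwards [h2.eventually_le_const hε] with k hk
      rw [← integral_finsetSum] at hk
      · have e : (fun z => inner ℝ (w k z).1 (G z).1)
            = fun z => ∑ i, (w k z).1 i * (G z).1 i := by
          funext z
          simp [PiLp.inner_apply, mul_comm]
        rw [e]
        exact hk
      · intro i _
        exact integrable_velocity_mul (hw.linear k) (hT G hG).toIsLinearSolution i
    have := (List.finite_toSet T).eventually_all (l := (atTop : Filter ℕ))
      (p := fun G k => |∫ z, inner ℝ (w k z).1 (G z).1| ≤ ε)
    exact this.2 h
  obtain ⟨k, hk1, hk2, hk3, hk4⟩ :=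
    (hw.mem.and (hw.gain.and ((hw.trace ε hε).and hweak))).exists
  refine ⟨F + w k, ⟨hF.toIsLinearSolution.add (hw.linear k), ?_, fun z => ?_⟩, ?_, ?_, ?_⟩
  · refine (tsupport_add F (w k)).trans (Set.union_subset hF.tsupport_subset ?_)
    refine (closure_minimal (fun z hz => ?_) hS.isClosed).trans hSΩ
    by_contra h
    exact hz (hw.eq_zero k z h)
  · by_cases hz : z ∈ S
    · exact hk1 z hz
    · rw [Pi.add_apply, hw.eq_zero k z hz, add_zero]
      exact hF.mem z
  · simpa using hk2
  · intro z
    rw [Pi.add_apply, fluxTrace_add, add_sub_cancel_left]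
    exact hk3 z
  · intro G hG
    simpa using hk4 G hG

theorem exists_subsolution_seq (hn : 2 ≤ n)
    (hΩ : Bornology.IsBounded (Ω : Set (SpaceTime n))) :
    ∃ F : ℕ → SpaceTime n → State n, F 0 = 0 ∧ (∀ k, IsSubsolution Ω (F k)) ∧
      (∀ k, gainConst n / 2 * ∫ z in (Ω : Set (SpaceTime n)), defectSq (F k z)
        ≤ ∫ z, ‖(F (k + 1) z).1 - (F k z).1‖ ^ 2) ∧
      (∀ k z, |fluxTrace (F (k + 1) z) - fluxTrace (F k z)| ≤ 2⁻¹ ^ k) ∧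
      ∀ j k, j ≤ k → |∫ z, inner ℝ ((F (k + 1) z).1 - (F k z).1) (F j z).1| ≤ 2⁻¹ ^ k := by
  let X := {l : List (SpaceTime n → State n) // l ≠ [] ∧ ∀ G ∈ l, IsSubsolution Ω G}
  have hstep : ∀ (k : ℕ) (l : X), ∃ F', IsSubsolution Ω F' ∧
      gainConst n / 2 * ∫ z in (Ω : Set (SpaceTime n)), defectSq (l.1.head l.2.1 z)
        ≤ ∫ z, ‖(F' z).1 - (l.1.head l.2.1 z).1‖ ^ 2 ∧
      (∀ z, |fluxTrace (F' z) - fluxTrace (l.1.head l.2.1 z)| ≤ 2⁻¹ ^ k) ∧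
      ∀ G ∈ l.1, |∫ z, inner ℝ ((F' z).1 - (l.1.head l.2.1 z).1) (G z).1| ≤ 2⁻¹ ^ k :=
    fun k l => exists_subsolution_step hn hΩ (l.2.2 _ (List.head_mem l.2.1)) l.1 l.2.2
      (by positivity)
  choose next hnext using hstep
  let L : ℕ → X := fun k => Nat.rec
    (⟨[0], by simp, by simpa using isSubsolution_zero (by omega)⟩ : X)
    (fun k l => ⟨next k l :: l.1, by simp, by
      simpa using ⟨(hnext k l).1, l.2.2⟩⟩) k
  let F : ℕ → SpaceTime n → State n := fun k => (L k).1.head (L k).2.1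
  have hL : ∀ k, (L (k + 1)).1 = next k (L k) :: (L k).1 := fun k => rfl
  have hFs : ∀ k, F (k + 1) = next k (L k) := fun k => rfl
  have hmem : ∀ j k, j ≤ k → F j ∈ (L k).1 := by
    intro j k hjk
    induction k, hjk using Nat.le_induction with
    | base => exact List.head_mem _
    | succ k _ ih =>
      rw [hL]
      exact List.mem_cons_of_mem _ ih
  refine ⟨F, rfl, fun k => (L k).2.2 _ (hmem k k le_rfl), fun k => ?_, fun k => ?_,
    fun j k hjk => ?_⟩
  · rw [hFs]
    exact (hnext k (L k)).2.1
  · rw [hFs]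
    exact (hnext k (L k)).2.2.1
  · rw [hFs]
    exact (hnext k (L k)).2.2.2 _ (hmem j k hjk)

/-- A bounded sequence in an inner product space whose increments are almost orthogonal to all
earlier terms is Cauchy. -/
theorem cauchySeq_of_almost_orthogonal {H : Type*} [NormedAddCommGroup H]
    [InnerProductSpace ℝ H] {V : ℕ → H} {B : ℝ} (hB : ∀ k, ‖V k‖ ≤ B)
    (h : ∀ j k, j ≤ k → |inner ℝ (V (k + 1) - V k) (V j)| ≤ 2⁻¹ ^ k) : CauchySeq V := by
  have hinner : ∀ k m, k ≤ m →
      |inner ℝ (V m - V k) (V k)| ≤ 2 * 2⁻¹ ^ k - 2 * 2⁻¹ ^ m := by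
    intro k m hkm
    induction m, hkm using Nat.le_induction with
    | base => simp
    | succ m hm ih =>
      have e : V (m + 1) - V k = (V (m + 1) - V m) + (V m - V k) := by abel
      rw [e, inner_add_left]
      refine (abs_add_le _ _).trans ?_
      have := h k m hm
      rw [pow_succ]
      linarith
  have hid : ∀ k m, ‖V m - V k‖ ^ 2
      = ‖V m‖ ^ 2 - ‖V k‖ ^ 2 - 2 * inner ℝ (V m - V k) (V k) := by
    intro k m
    have e : V m = (V m - V k) + V k := by abel
    have := norm_add_sq_real (V m - V k) (V k)
    rw [← e] at this
    linarith
  let b : ℕ → ℝ := fun k => ‖V k‖ ^ 2 - 4 * 2⁻¹ ^ k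
  have hle : ∀ k m, k ≤ m → ‖V m - V k‖ ^ 2 ≤ b m - b k := by
    intro k m hkm
    have h1 := (abs_le.1 (hinner k m hkm)).1
    rw [hid]
    simp only [b]
    linarith
  have hmono : Monotone b := fun k m hkm => by
    have := (sq_nonneg _).trans (hle k m hkm)
    linarith
  have hbdd : BddAbove (Set.range b) := by
    refine ⟨B ^ 2, ?_⟩
    rintro _ ⟨k, rfl⟩
    have h1 : ‖V k‖ ^ 2 ≤ B ^ 2 := pow_le_pow_left₀ (norm_nonneg _) (hB k) 2
    have h2 : (0 : ℝ) ≤ 2⁻¹ ^ k := by positivity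
    simp only [b]
    linarith
  have hcau := (tendsto_atTop_ciSup hmono hbdd).cauchySeq
  rw [Metric.cauchySeq_iff'] at hcau ⊢
  intro ε hε
  obtain ⟨N, hN⟩ := hcau (ε ^ 2) (by positivity)
  refine ⟨N, fun m hm => ?_⟩
  have h1 := (le_abs_self _).trans_lt (hN m hm)
  rw [dist_eq_norm]
  exact lt_of_pow_lt_pow_left₀ 2 hε.le ((hle N m hm).trans_lt h1)

theorem IsSubsolution.eq_zero {F : SpaceTime n → State n} (hF : IsSubsolution Ω F)
    {z : SpaceTime n} (hz : z ∉ Ω) : F z = 0 :=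
  image_eq_zero_of_notMem_tsupport fun h => hz (hF.tsupport_subset h)

theorem IsSubsolution.norm_velocity_le {F : SpaceTime n → State n} (hn : 0 < n)
    (hF : IsSubsolution Ω F) (z : SpaceTime n) : ‖(F z).1‖ ≤ 1 := by
  have := norm_lt_one hn (hF.mem z)
  nlinarith [norm_nonneg (F z).1]

theorem IsLinearSolution.continuous_velocity {F : SpaceTime n → State n}
    (hF : IsLinearSolution F) : Continuous fun z => (F z).1 :=
  continuous_fst.comp hF.smooth.continuous

theorem IsLinearSolution.memLp_velocity {F : SpaceTime n → State n} (hF : IsLinearSolution F) :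
    MemLp (fun z => (F z).1) 2 volume :=
  hF.continuous_velocity.memLp_of_hasCompactSupport
    (hF.compact.comp_left (g := fun P : State n => P.1) rfl)

/-- Subsolutions whose velocities converge almost everywhere to a field of modulus one on `Ω`. -/
theorem exists_convergent_subsolution_seq (hn : 2 ≤ n)
    (hΩ : Bornology.IsBounded (Ω : Set (SpaceTime n))) :
    ∃ (F : ℕ → SpaceTime n → State n) (v : SpaceTime n → Space n) (T : SpaceTime n → ℝ),
      (∀ k, IsSubsolution Ω (F k)) ∧ AEStronglyMeasurable v volume ∧
      (∀ k z, |fluxTrace (F k z)| ≤ 2) ∧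
      (∀ z, Tendsto (fun k => fluxTrace (F k z)) atTop (𝓝 (T z))) ∧
      (∀ᵐ z, Tendsto (fun k => (F k z).1) atTop (𝓝 (v z))) ∧
      (∀ᵐ z, z ∈ Ω → ‖v z‖ = 1) := by
  have hn0 : 0 < n := by omega
  obtain ⟨F, hF0, hF, hgain, htr, horth⟩ := exists_subsolution_seq hn hΩ
  have htr' : ∀ k z, |fluxTrace (F k z)| ≤ 2 - 2 * 2⁻¹ ^ k := by
    intro k z
    induction k with
    | zero => simp [hF0, fluxTrace]
    | succ k ih =>
      have h1 := htr k z
      have h2 := abs_sub_abs_le_abs_sub (fluxTrace (F (k + 1) z)) (fluxTrace (F k z))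
      rw [pow_succ]
      linarith
  have hT : ∀ z, ∃ T, Tendsto (fun k => fluxTrace (F k z)) atTop (𝓝 T) := fun z => by
    refine cauchySeq_tendsto_of_complete (cauchySeq_of_le_geometric 2⁻¹ 1 (by norm_num)
      fun k => ?_)
    rw [dist_comm, Real.dist_eq, one_mul]
    exact htr k z
  choose T hT using hT
  have hmem : ∀ k, MemLp (fun z => (F k z).1) 2 volume := fun k => (hF k).memLp_velocity
  let V : ℕ → Lp (Space n) 2 (volume : Measure (SpaceTime n)) := fun k => (hmem k).toLp
  have hsub : ∀ k m, V m - V k = ((hmem m).sub (hmem k)).toLp := fun k m => rfl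
  have hdiff : ∀ k m, ‖V m - V k‖ ^ 2 = ∫ z, ‖(F m z).1 - (F k z).1‖ ^ 2 := by
    intro k m
    rw [← real_inner_self_eq_norm_sq, hsub, L2.inner_def]
    apply integral_congr_ae
    filter_upwards [((hmem m).sub (hmem k)).coeFn_toLp] with z hz
    rw [hz, real_inner_self_eq_norm_sq]
    rfl
  have hVB : ∀ k, ‖V k‖ ≤ Real.sqrt (volume.real (Ω : Set (SpaceTime n))) := by
    intro k
    apply Real.le_sqrt_of_sq_le
    rw [← real_inner_self_eq_norm_sq, L2.inner_def]
    have h1 : ∫ z, inner ℝ (V k z) (V k z) = ∫ z, ‖(F k z).1‖ ^ 2 := by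
      apply integral_congr_ae
      filter_upwards [(hmem k).coeFn_toLp] with z hz
      rw [hz, real_inner_self_eq_norm_sq]
    rw [h1]
    have h2 : ∫ z, ‖(F k z).1‖ ^ 2
        ≤ ∫ z, (Ω : Set (SpaceTime n)).indicator (fun _ => (1 : ℝ)) z := by
      apply integral_mono (hF k).integrable_norm_sq
      · exact (integrable_indicator_iff Ω.isOpen.measurableSet).2
          (integrableOn_const hΩ.measure_lt_top.ne)
      · intro z
        by_cases hz : z ∈ (Ω : Set (SpaceTime n))
        · simp only [Set.indicator_of_mem hz]
          exact pow_le_one₀ (norm_nonneg _) ((hF k).norm_velocity_le hn0 z)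
        · simp [Set.indicator_of_notMem hz, (hF k).eq_zero hz]
    refine h2.trans (le_of_eq ?_)
    rw [integral_indicator Ω.isOpen.measurableSet, setIntegral_const, smul_eq_mul, mul_one]
  have hcau : CauchySeq V := by
    refine cauchySeq_of_almost_orthogonal hVB fun j k hjk => ?_
    refine le_trans (le_of_eq ?_) (horth j k hjk)
    rw [hsub, L2.inner_def]
    congr 1
    apply integral_congr_ae
    filter_upwards [((hmem (k + 1)).sub (hmem k)).coeFn_toLp, (hmem j).coeFn_toLp] with z hz hz'
    rw [hz, hz']
    rfl
  obtain ⟨v, hv⟩ := cauchySeq_tendsto_of_complete hcau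
  have hdefect : Tendsto (fun k => ∫ z in (Ω : Set (SpaceTime n)), defectSq (F k z))
      atTop (𝓝 0) := by
    have h1 : Tendsto (fun k => ‖V (k + 1) - V k‖ ^ 2) atTop (𝓝 0) := by
      have := ((hv.comp (tendsto_add_atTop_nat 1)).sub hv).norm.pow 2
      simpa using this
    have hc : 0 < gainConst n / 2 := half_pos (gainConst_pos hn0)
    have h2 := h1.const_mul (gainConst n / 2)⁻¹
    rw [mul_zero] at h2
    refine squeeze_zero (fun k => integral_nonneg fun z => sq_nonneg _) (fun k => ?_) h2
    rw [hdiff, inv_mul_eq_div, le_div_iff₀ hc, mul_comm]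
    exact hgain k
  obtain ⟨ns, hns, hae⟩ := (tendstoInMeasure_of_tendsto_Lp hv).exists_seq_tendsto_ae
  have hae' : ∀ᵐ z, Tendsto (fun k => (F (ns k) z).1) atTop (𝓝 (v z)) := by
    have h1 : ∀ᵐ z, ∀ k, V k z = (F k z).1 := ae_all_iff.2 fun k => (hmem k).coeFn_toLp
    filter_upwards [hae, h1] with z hz h1
    simpa only [h1] using hz
  refine ⟨fun k => F (ns k), v, T, fun k => hF _, Lp.aestronglyMeasurable v, fun k z => ?_,
    fun z => (hT z).comp hns.tendsto_atTop, hae', ?_⟩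
  · have h1 := htr' (ns k) z
    have h2 : (0 : ℝ) ≤ 2⁻¹ ^ ns k := by positivity
    linarith
  have hlim : Tendsto (fun k => ∫ z in (Ω : Set (SpaceTime n)), defectSq (F (ns k) z)) atTop
      (𝓝 (∫ z in (Ω : Set (SpaceTime n)), (1 - ‖v z‖ ^ 2) ^ 2)) := by
    refine tendsto_integral_of_dominated_convergence (fun _ => (1 : ℝ)) (fun k => ?_)
      (integrableOn_const hΩ.measure_lt_top.ne) (fun k => ?_) ?_
    · exact (continuous_defectSq.comp (hF (ns k)).smooth.continuous).aestronglyMeasurable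
    · refine Eventually.of_forall fun z => ?_
      have h1 := norm_lt_one hn0 ((hF (ns k)).mem z)
      have h2 := sq_nonneg ‖(F (ns k) z).1‖
      rw [Real.norm_eq_abs, defectSq, abs_of_nonneg (sq_nonneg _)]
      exact pow_le_one₀ (by linarith) (by linarith)
    · filter_upwards [ae_restrict_of_ae hae'] with z hz
      exact ((hz.norm.pow 2).const_sub 1).pow 2
  have hzero := tendsto_nhds_unique hlim (hdefect.comp hns.tendsto_atTop)
  have hle : ∀ᵐ z, ‖v z‖ ≤ 1 := by
    filter_upwards [hae'] with z hz
    exact le_of_tendsto' hz.norm fun k => (hF _).norm_velocity_le hn0 z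
  have hint : IntegrableOn (fun z => (1 - ‖v z‖ ^ 2) ^ 2) (Ω : Set (SpaceTime n)) volume := by
    refine Measure.integrableOn_of_bounded (M := 1) hΩ.measure_lt_top.ne ?_ ?_
    · exact ((aestronglyMeasurable_const.sub ((Lp.aestronglyMeasurable v).norm.pow 2)).pow 2)
    · filter_upwards [ae_restrict_of_ae hle] with z hz
      have h2 := sq_nonneg ‖v z‖
      rw [Real.norm_eq_abs, abs_of_nonneg (sq_nonneg _)]
      exact pow_le_one₀ (by nlinarith [norm_nonneg (v z)]) (by linarith)
  rw [integral_eq_zero_iff_of_nonneg (fun z => sq_nonneg _) hint, EventuallyEq,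
    ae_restrict_iff' Ω.isOpen.measurableSet] at hzero
  filter_upwards [hzero] with z hz hzΩ
  have h1 : (1 - ‖v z‖ ^ 2) ^ 2 = 0 := hz hzΩ
  have h2 : ‖v z‖ ^ 2 = 1 := by
    have := pow_eq_zero_iff (two_ne_zero) |>.1 h1
    linarith
  exact (pow_eq_one_iff_of_nonneg (norm_nonneg _) two_ne_zero).1 h2

end Iteration

/-- The pressure `(tr M - |v|²)/n` of a state `(v, M)`. -/
def pressure {n : ℕ} (P : State n) : ℝ := (fluxTrace P - ‖P.1‖ ^ 2) / n

/-- The error `v ⊗ v + p I - M` in the nonlinear relation between velocity and flux. -/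
def fluxError {n : ℕ} (P : State n) (i j : Fin n) : ℝ :=
  P.1 i * P.1 j + (if i = j then 1 else 0) * pressure P + -1 * P.2 i j

section Limit

variable {n : ℕ} {Ω : TopologicalSpace.Opens (SpaceTime n)} {F : SpaceTime n → State n}

theorem flux_eq (P : State n) (i j : Fin n) :
    P.2 i j = P.1 i * P.1 j + (if i = j then 1 else 0) * pressure P - fluxError P i j := by
  rw [fluxError]
  ring

theorem fluxError_eq (P : State n) (i j : Fin n) :
    fluxError P i j = (if i = j then 1 else 0) * ((1 - ‖P.1‖ ^ 2) / n) - stress P i j := by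
  rw [fluxError, stress_apply, pressure]
  split_ifs <;> ring

theorem IsSubsolution.abs_fluxError_le (hn : 0 < n) (hF : IsSubsolution Ω F) (z : SpaceTime n)
    (i j : Fin n) : |fluxError (F z) i j| ≤ 2 * (1 - ‖(F z).1‖ ^ 2) := by
  have hn1 : (1 : ℝ) ≤ n := by exact_mod_cast hn
  have h1 := abs_stress_le hn (hF.symm z) (hF.mem z) i j
  have h0 : 0 ≤ 1 - ‖(F z).1‖ ^ 2 := (abs_nonneg _).trans h1
  have h2 : |(if i = j then (1 : ℝ) else 0) * ((1 - ‖(F z).1‖ ^ 2) / n)|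
      ≤ 1 - ‖(F z).1‖ ^ 2 := by
    split_ifs
    · rw [one_mul, abs_of_nonneg (by positivity)]
      exact div_le_self h0 hn1
    · simpa using h0
  rw [fluxError_eq]
  refine (abs_sub _ _).trans ?_
  linarith

theorem abs_velocity_le (v : Space n) (i : Fin n) : |v i| ≤ ‖v‖ := PiLp.norm_apply_le v i

theorem pressure_zero : pressure (0 : State n) = 0 := by
  simp [pressure, fluxTrace]

theorem fluxError_zero (i j : Fin n) : fluxError (0 : State n) i j = 0 := by
  simp [fluxError, pressure_zero]

theorem IsSubsolution.abs_fluxError_le_two (hn : 0 < n) (hF : IsSubsolution Ω F)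
    (z : SpaceTime n) (i j : Fin n) : |fluxError (F z) i j| ≤ 2 := by
  have := hF.abs_fluxError_le hn z i j
  nlinarith [sq_nonneg ‖(F z).1‖]

theorem IsSubsolution.abs_pressure_le (hn : 0 < n) (hF : IsSubsolution Ω F) {z : SpaceTime n}
    (hT : |fluxTrace (F z)| ≤ 2) : |pressure (F z)| ≤ 3 := by
  have hn1 : (1 : ℝ) ≤ n := by exact_mod_cast hn
  have h1 := norm_lt_one hn (hF.mem z)
  rw [pressure, abs_div, abs_of_pos (by linarith : (0 : ℝ) < n)]
  refine (div_le_self (abs_nonneg _) hn1).trans ((abs_sub _ _).trans ?_)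
  rw [abs_of_nonneg (sq_nonneg ‖(F z).1‖)]
  linarith

theorem contDiff_pressure (hF : ContDiff ℝ ∞ F) : ContDiff ℝ ∞ fun z => pressure (F z) := by
  have h1 : ContDiff ℝ ∞ fun z => fluxTrace (F z) :=
    ContDiff.sum fun i _ => contDiff_flux hF i i
  have h2 : ContDiff ℝ ∞ fun z => ‖(F z).1‖ ^ 2 := (contDiff_fst.comp hF).norm_sq ℝ
  exact (h1.sub h2).div_const _

theorem contDiff_fluxError (hF : ContDiff ℝ ∞ F) (i j : Fin n) :
    ContDiff ℝ ∞ fun z => fluxError (F z) i j :=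
  (((contDiff_velocity hF i).mul (contDiff_velocity hF j)).add
    (contDiff_const.mul (contDiff_pressure hF))).add (contDiff_const.mul (contDiff_flux hF i j))

theorem hasCompactSupport_fluxError (hF : HasCompactSupport F) (i j : Fin n) :
    HasCompactSupport fun z => fluxError (F z) i j :=
  hF.comp_left (g := fun P : State n => fluxError P i j) (fluxError_zero i j)

/-- The divergence of the flux error. -/
def fluxForce (F : SpaceTime n → State n) (z : SpaceTime n) : Space n :=
  WithLp.toLp 2 fun i => ∑ j, dx j (fun y => fluxError (F y) i j) z

theorem contDiff_fluxForce (hF : ContDiff ℝ ∞ F) : ContDiff ℝ ∞ (fluxForce F) :=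
  contDiff_euclidean.2 fun i => by
    have h : ContDiff ℝ ∞ fun z => ∑ j, dx j (fun y => fluxError (F y) i j) z :=
      ContDiff.sum fun j _ => contDiff_dirDeriv (contDiff_fluxError hF i j) _
    exact h

theorem tsupport_fluxForce_subset (F : SpaceTime n → State n) :
    tsupport (fluxForce F) ⊆ tsupport F := by
  refine closure_minimal (fun z hz => ?_) (isClosed_tsupport F)
  by_contra h
  refine hz ?_
  have h0 : ∀ i j, dx j (fun y => fluxError (F y) i j) z = 0 := fun i j =>
    dirDeriv_eq_zero _ fun h' =>
      h (tsupport_comp_subset (g := fun P : State n => fluxError P i j) (fluxError_zero i j) F h')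
  simp only [fluxForce, h0, Finset.sum_const_zero]
  rfl

/-- The velocity of a subsolution, as a test function. -/
def velocityTest (hF : IsSubsolution Ω F) : 𝓓(Ω, Space n) where
  toFun z := (F z).1
  contDiff' := contDiff_fst.comp hF.smooth
  hasCompactSupport' := hF.compact.comp_left (g := fun P : State n => P.1) rfl
  tsupport_subset' :=
    (tsupport_comp_subset (g := fun P : State n => P.1) rfl F).trans hF.tsupport_subset

/-- The pressure of a subsolution, as a test function. -/
def pressureTest (hF : IsSubsolution Ω F) : 𝓓(Ω, ℝ) where
  toFun z := pressure (F z)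
  contDiff' := contDiff_pressure hF.smooth
  hasCompactSupport' := hF.compact.comp_left (g := pressure) pressure_zero
  tsupport_subset' := (tsupport_comp_subset pressure_zero F).trans hF.tsupport_subset

/-- The force of a subsolution, as a test function. -/
def forceTest (hF : IsSubsolution Ω F) : 𝓓(Ω, Space n) where
  toFun := fluxForce F
  contDiff' := contDiff_fluxForce hF.smooth
  hasCompactSupport' :=
    hF.compact.of_isClosed_subset (isClosed_tsupport _) (tsupport_fluxForce_subset F)
  tsupport_subset' := (tsupport_fluxForce_subset F).trans hF.tsupport_subset

theorem isClassicalSolution (hF : IsLinearSolution F) :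
    IsClassicalSolution (fun z => (F z).1) (fun z => pressure (F z)) (fluxForce F) where
  momentum z i := by
    have hv := contDiff_velocity hF.smooth
    have hp := contDiff_pressure hF.smooth
    have hM := contDiff_flux hF.smooth
    have h : ∀ j, dx j (fun y => fluxError (F y) i j) z
        = dx j (fun y => (F y).1 i * (F y).1 j) z
          + (if i = j then 1 else 0) * dx j (fun y => pressure (F y)) z
          + -1 * dx j (fun y => (F y).2 i j) z := by
      intro j
      simp only [dx_eq_dirDeriv, fluxError]
      rw [dirDeriv_add (((hv i).mul (hv j)).add (contDiff_const.mul hp))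
        (contDiff_const.mul (hM i j)), dirDeriv_add ((hv i).mul (hv j)) (contDiff_const.mul hp),
        dirDeriv_const_mul hp, dirDeriv_const_mul (hM i j)]
    have h2 := hF.momentum z i
    simp only [fluxForce, h, Finset.sum_add_distrib, ← Finset.mul_sum, ite_mul, one_mul, zero_mul,
      Finset.sum_ite_eq, Finset.mem_univ, if_true]
    linarith
  incompressible := hF.incompressible

section TestFunctions

variable (φ : 𝓓((⊤ : TopologicalSpace.Opens (SpaceTime n)), Space n))

theorem contDiff_testComponent (i : Fin n) : ContDiff ℝ ∞ fun y => φ y i :=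
  contDiff_euclidean.1 φ.contDiff i

theorem hasCompactSupport_testComponent (i : Fin n) : HasCompactSupport fun y => φ y i :=
  φ.hasCompactSupport.comp_left (g := fun x : Space n => x i) rfl

theorem continuous_dx {G : Type*} [NormedAddCommGroup G] [NormedSpace ℝ G]
    {g : SpaceTime n → G} (hg : ContDiff ℝ ∞ g) (j : Fin n) : Continuous (dx j g) :=
  (hg.continuous_fderiv (by simp)).clm_apply continuous_const

theorem continuous_dt {G : Type*} [NormedAddCommGroup G] [NormedSpace ℝ G]
    {g : SpaceTime n → G} (hg : ContDiff ℝ ∞ g) : Continuous (dt g) :=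
  (hg.continuous_fderiv (by simp)).clm_apply continuous_const

theorem dx_component (j i : Fin n) (z : SpaceTime n) :
    dx j (fun y => φ y i) z = (dx j φ z) i := by
  have h := (differentiable_of_smooth φ.contDiff z).hasFDerivAt
  have h2 := (EuclideanSpace.proj (𝕜 := ℝ) i : Space n →L[ℝ] ℝ).hasFDerivAt.comp z h
  change fderiv ℝ ((EuclideanSpace.proj (𝕜 := ℝ) i : Space n →L[ℝ] ℝ) ∘ φ) z _ = _
  rw [h2.fderiv]
  rfl

theorem integrable_dirDeriv_test (w : SpaceTime n) (i : Fin n) :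
    Integrable (dirDeriv w fun y => φ y i) :=
  (contDiff_dirDeriv (contDiff_testComponent φ i) w).continuous.integrable_of_hasCompactSupport
    (hasCompactSupport_dirDeriv (hasCompactSupport_testComponent φ i) w)

theorem integral_gradient_sq_le :
    Integrable (fun z => ∑ i, ∑ j, dx j (fun y => φ y i) z ^ 2) ∧
      ∫ z, ∑ i, ∑ j, dx j (fun y => φ y i) z ^ 2 ≤ h1NormSq φ := by
  have hcont : Continuous fun z => ‖φ z‖ ^ 2 + ‖dt φ z‖ ^ 2 + ∑ j, ‖dx j φ z‖ ^ 2 := by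
    have h1 := continuous_dt φ.contDiff
    have h2 := continuous_dx φ.contDiff
    fun_prop
  have hzero : ∀ z, z ∉ tsupport φ → ‖φ z‖ ^ 2 + ‖dt φ z‖ ^ 2 + ∑ j, ‖dx j φ z‖ ^ 2 = 0 := by
    intro z hz
    have h1 : fderiv ℝ φ z = 0 :=
      image_eq_zero_of_notMem_tsupport fun h => hz (tsupport_fderiv_subset ℝ h)
    simp [dt, dx, h1, image_eq_zero_of_notMem_tsupport hz]
  have hint := hcont.integrable_of_hasCompactSupport (μ := volume)
    (HasCompactSupport.intro φ.hasCompactSupport hzero)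
  have heq : ∀ z, ∑ i, ∑ j, dx j (fun y => φ y i) z ^ 2 = ∑ j, ‖dx j φ z‖ ^ 2 := by
    intro z
    rw [Finset.sum_comm]
    refine Finset.sum_congr rfl fun j _ => ?_
    rw [EuclideanSpace.real_norm_sq_eq]
    simp only [dx_component]
  have hle : ∀ z, ∑ i, ∑ j, dx j (fun y => φ y i) z ^ 2
      ≤ ‖φ z‖ ^ 2 + ‖dt φ z‖ ^ 2 + ∑ j, ‖dx j φ z‖ ^ 2 := by
    intro z
    rw [heq]
    have : 0 ≤ ‖φ z‖ ^ 2 + ‖dt φ z‖ ^ 2 := by positivity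
    linarith
  have hint' : Integrable (fun z => ∑ i, ∑ j, dx j (fun y => φ y i) z ^ 2) := by
    refine hint.mono' ?_ (Eventually.of_forall fun z => ?_)
    · apply Continuous.aestronglyMeasurable
      have h2 := fun i j => continuous_dx (contDiff_testComponent φ i) j
      fun_prop
    · rw [Real.norm_eq_abs, abs_of_nonneg (Finset.sum_nonneg fun i _ =>
        Finset.sum_nonneg fun j _ => sq_nonneg _)]
      exact hle z
  exact ⟨hint', integral_mono hint' hint hle⟩

theorem integral_fluxForce_mul (hF : IsLinearSolution F) :
    ∫ z, ∑ i, fluxForce F z i * φ z i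
      = -∫ z, ∑ i, ∑ j, fluxError (F z) i j * dx j (fun y => φ y i) z := by
  have hD := contDiff_fluxError hF.smooth
  have hDc := hasCompactSupport_fluxError hF.compact
  have hφ := contDiff_testComponent φ
  have i1 : ∀ i j, Integrable (fun z => dx j (fun y => fluxError (F y) i j) z * φ z i) :=
    fun i j => ((contDiff_dirDeriv (hD i j) _).continuous.mul
      (hφ i).continuous).integrable_of_hasCompactSupport
      (hasCompactSupport_dirDeriv (hDc i j) _).mul_right
  have i2 : ∀ i j, Integrable (fun z => fluxError (F z) i j * dx j (fun y => φ y i) z) :=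
    fun i j => ((hD i j).continuous.mul
      (contDiff_dirDeriv (hφ i) _).continuous).integrable_of_hasCompactSupport (hDc i j).mul_right
  simp only [fluxForce, Finset.sum_mul]
  rw [integral_finsetSum _ fun i _ => integrable_finsetSum _ fun j _ => i1 i j,
    integral_finsetSum _ fun i _ => integrable_finsetSum _ fun j _ => i2 i j,
    ← Finset.sum_neg_distrib]
  refine Finset.sum_congr rfl fun i _ => ?_
  rw [integral_finsetSum _ fun j _ => i1 i j, integral_finsetSum _ fun j _ => i2 i j,
    ← Finset.sum_neg_distrib]
  refine Finset.sum_congr rfl fun j _ => ?_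
  have := integral_mul_dirDeriv volume (hD i j) (hφ i) (hDc i j) (EuclideanSpace.single j 1, 0)
  simp only [dx_eq_dirDeriv]
  rw [this, neg_neg]

theorem integral_linear_momentum (hF : IsLinearSolution F) :
    ∫ z, ((∑ i, (F z).1 i * dt (fun y => φ y i) z)
      + ∑ i, ∑ j, (F z).2 i j * dx j (fun y => φ y i) z) = 0 := by
  have hv := contDiff_velocity hF.smooth
  have hvc := hasCompactSupport_velocity hF.compact
  have hM := contDiff_flux hF.smooth
  have hMc := hasCompactSupport_flux hF.compact
  have hφ := contDiff_testComponent φ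
  have i1 : ∀ i, Integrable (fun z => (F z).1 i * dt (fun y => φ y i) z) := fun i =>
    ((hv i).continuous.mul
      (contDiff_dirDeriv (hφ i) _).continuous).integrable_of_hasCompactSupport (hvc i).mul_right
  have i2 : ∀ i j, Integrable (fun z => (F z).2 i j * dx j (fun y => φ y i) z) := fun i j =>
    ((hM i j).continuous.mul
      (contDiff_dirDeriv (hφ i) _).continuous).integrable_of_hasCompactSupport (hMc i j).mul_right
  have i3 : ∀ i, Integrable (fun z => dt (fun y => (F y).1 i) z * φ z i) := fun i =>
    ((contDiff_dirDeriv (hv i) _).continuous.mul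
      (hφ i).continuous).integrable_of_hasCompactSupport
      (hasCompactSupport_dirDeriv (hvc i) _).mul_right
  have i4 : ∀ i j, Integrable (fun z => dx j (fun y => (F y).2 i j) z * φ z i) := fun i j =>
    ((contDiff_dirDeriv (hM i j) _).continuous.mul
      (hφ i).continuous).integrable_of_hasCompactSupport
      (hasCompactSupport_dirDeriv (hMc i j) _).mul_right
  rw [integral_add (integrable_finsetSum _ fun i _ => i1 i)
    (integrable_finsetSum _ fun i _ => integrable_finsetSum _ fun j _ => i2 i j),
    integral_finsetSum _ fun i _ => i1 i,
    integral_finsetSum _ fun i _ => integrable_finsetSum _ fun j _ => i2 i j,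
    ← Finset.sum_add_distrib]
  refine Finset.sum_eq_zero fun i _ => ?_
  rw [integral_finsetSum _ fun j _ => i2 i j]
  have e1 : ∫ z, (F z).1 i * dt (fun y => φ y i) z
      = -∫ z, dt (fun y => (F y).1 i) z * φ z i :=
    integral_mul_dirDeriv volume (hv i) (hφ i) (hvc i) (0, 1)
  have e2 : ∀ j, ∫ z, (F z).2 i j * dx j (fun y => φ y i) z
      = -∫ z, dx j (fun y => (F y).2 i j) z * φ z i := fun j =>
    integral_mul_dirDeriv volume (hM i j) (hφ i) (hMc i j) (EuclideanSpace.single j 1, 0)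
  simp only [e1, e2]
  rw [Finset.sum_neg_distrib, ← integral_finsetSum _ fun j _ => i4 i j, ← neg_add,
    ← integral_add (i3 i) (integrable_finsetSum _ fun j _ => i4 i j), neg_eq_zero]
  have e3 : (fun z => dt (fun y => (F y).1 i) z * φ z i
      + ∑ j, dx j (fun y => (F y).2 i j) z * φ z i) = fun _ => 0 := by
    funext z
    rw [← Finset.sum_mul, ← add_mul, hF.momentum z i, zero_mul]
  rw [e3, integral_zero]

end TestFunctions

theorem integral_linear_incompressible (hF : IsLinearSolution F)
    (ψ : 𝓓((⊤ : TopologicalSpace.Opens (SpaceTime n)), ℝ)) :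
    ∫ z, ∑ j, (F z).1 j * dx j ψ z = 0 := by
  have hv := contDiff_velocity hF.smooth
  have hvc := hasCompactSupport_velocity hF.compact
  have hψ : ContDiff ℝ ∞ ψ := ψ.contDiff
  have i1 : ∀ j, Integrable (fun z => (F z).1 j * dx j ψ z) := fun j =>
    ((hv j).continuous.mul
      (contDiff_dirDeriv hψ _).continuous).integrable_of_hasCompactSupport (hvc j).mul_right
  have i2 : ∀ j, Integrable (fun z => dx j (fun y => (F y).1 j) z * ψ z) := fun j =>
    ((contDiff_dirDeriv (hv j) _).continuous.mul
      hψ.continuous).integrable_of_hasCompactSupport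
      (hasCompactSupport_dirDeriv (hvc j) _).mul_right
  have e : ∀ j, ∫ z, (F z).1 j * dx j ψ z = -∫ z, dx j (fun y => (F y).1 j) z * ψ z := fun j =>
    integral_mul_dirDeriv volume (hv j) hψ (hvc j) (EuclideanSpace.single j 1, 0)
  rw [integral_finsetSum _ fun j _ => i1 j]
  simp only [e]
  rw [Finset.sum_neg_distrib, ← integral_finsetSum _ fun j _ => i2 j]
  simp only [← Finset.sum_mul, hF.incompressible, zero_mul, integral_zero, neg_zero]

theorem IsLinearSolution.integrable_fluxError_sq (hF : IsLinearSolution F) :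
    Integrable (fun z => ∑ i, ∑ j, fluxError (F z) i j ^ 2) := by
  refine integrable_finsetSum _ fun i _ => integrable_finsetSum _ fun j _ => ?_
  have h1 : Continuous fun z => fluxError (F z) i j ^ 2 :=
    (contDiff_fluxError hF.smooth i j).continuous.pow 2
  have h2 : HasCompactSupport fun z => fluxError (F z) i j ^ 2 :=
    (hasCompactSupport_fluxError hF.compact i j).comp_left (g := fun x : ℝ => x ^ 2) (by norm_num)
  exact h1.integrable_of_hasCompactSupport h2

/-- The `H⁻¹` norm of the force is controlled by the `L²` norm of the flux error. -/
theorem hNegOneNorm_fluxForce_le (hF : IsLinearSolution F) {l : ℝ} (hl : 0 < l) :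
    hNegOneNorm (fluxForce F)
      ≤ ENNReal.ofReal ((∫ z, ∑ i, ∑ j, fluxError (F z) i j ^ 2) / (2 * l) + l / 2) := by
  refine iSup₂_le fun φ hφ => ENNReal.ofReal_le_ofReal ?_
  obtain ⟨hgi, hgle⟩ := integral_gradient_sq_le φ
  have hDi := hF.integrable_fluxError_sq
  rw [integral_fluxForce_mul φ hF, abs_neg]
  have hpt : ∀ z, |∑ i, ∑ j, fluxError (F z) i j * dx j (fun y => φ y i) z|
      ≤ (∑ i, ∑ j, fluxError (F z) i j ^ 2) / (2 * l)
        + l / 2 * ∑ i, ∑ j, dx j (fun y => φ y i) z ^ 2 := by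
    intro z
    refine (Finset.abs_sum_le_sum_abs _ _).trans ?_
    rw [Finset.sum_div, Finset.mul_sum, ← Finset.sum_add_distrib]
    refine Finset.sum_le_sum fun i _ => (Finset.abs_sum_le_sum_abs _ _).trans ?_
    rw [Finset.sum_div, Finset.mul_sum, ← Finset.sum_add_distrib]
    refine Finset.sum_le_sum fun j _ => ?_
    set a := fluxError (F z) i j
    set b := dx j (fun y => φ y i) z
    rw [abs_mul, ← sq_abs a, ← sq_abs b, div_add' _ _ _ (by positivity),
      le_div_iff₀ (by positivity)]
    nlinarith [sq_nonneg (|a| - l * |b|)]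
  calc |∫ z, ∑ i, ∑ j, fluxError (F z) i j * dx j (fun y => φ y i) z|
      ≤ ∫ z, |∑ i, ∑ j, fluxError (F z) i j * dx j (fun y => φ y i) z| :=
        abs_integral_le_integral_abs
    _ ≤ ∫ z, ((∑ i, ∑ j, fluxError (F z) i j ^ 2) / (2 * l)
        + l / 2 * ∑ i, ∑ j, dx j (fun y => φ y i) z ^ 2) :=
        integral_mono_of_nonneg (Eventually.of_forall fun z => abs_nonneg _)
          ((hDi.div_const _).add (hgi.const_mul _)) (Eventually.of_forall hpt)
    _ = (∫ z, ∑ i, ∑ j, fluxError (F z) i j ^ 2) / (2 * l)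
        + l / 2 * ∫ z, ∑ i, ∑ j, dx j (fun y => φ y i) z ^ 2 := by
        rw [integral_add (hDi.div_const _) (hgi.const_mul _), integral_div, integral_const_mul]
    _ ≤ _ := by
        have := mul_le_mul_of_nonneg_left (hgle.trans hφ) (half_pos hl).le
        linarith

theorem tendsto_hNegOneNorm_fluxForce {F : ℕ → SpaceTime n → State n}
    (hF : ∀ k, IsLinearSolution (F k))
    (h : Tendsto (fun k => ∫ z, ∑ i, ∑ j, fluxError (F k z) i j ^ 2) atTop (𝓝 0)) :
    Tendsto (fun k => hNegOneNorm (fluxForce (F k))) atTop (𝓝 0) := by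
  set S : ℕ → ℝ := fun k => ∫ z, ∑ i, ∑ j, fluxError (F k z) i j ^ 2 with hS
  have hS0 : ∀ k, 0 ≤ S k := fun k => integral_nonneg fun z => Finset.sum_nonneg fun i _ =>
    Finset.sum_nonneg fun j _ => sq_nonneg _
  have hsqrt : Tendsto (fun k => √(S k)) atTop (𝓝 0) := by
    simpa using h.sqrt
  have hlim : Tendsto (fun k : ℕ => √(S k) / 2 + (√(S k) + 1 / ((k : ℝ) + 1)) / 2)
      atTop (𝓝 0) := by
    simpa using (hsqrt.div_const 2).add ((hsqrt.add (tendsto_const_div_add_one 1)).div_const 2)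
  have hlim' := ENNReal.tendsto_ofReal hlim
  rw [ENNReal.ofReal_zero] at hlim'
  refine tendsto_of_tendsto_of_tendsto_of_le_of_le tendsto_const_nhds hlim'
    (fun k => zero_le) fun k => ?_
  have hpos : (0 : ℝ) < 1 / ((k : ℝ) + 1) := by positivity
  have hl : 0 < √(S k) + 1 / ((k : ℝ) + 1) := add_pos_of_nonneg_of_pos (Real.sqrt_nonneg _) hpos
  refine (hNegOneNorm_fluxForce_le (hF k) hl).trans (ENNReal.ofReal_le_ofReal ?_)
  refine add_le_add ?_ le_rfl
  rw [div_le_div_iff₀ (by positivity) (by positivity)]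
  have := Real.mul_self_sqrt (hS0 k)
  change S k * 2 ≤ _
  nlinarith [Real.sqrt_nonneg (S k)]

/-- Uniformly bounded functions on a set of finite measure that converge to zero almost everywhere
converge to zero in every `Lᵠ`. -/
theorem tendsto_eLpNorm_zero_of_bounded {α G : Type*} [MeasurableSpace α] {μ : Measure α}
    [NormedAddCommGroup G] {s : Set α} (hs : MeasurableSet s) (hμs : μ s ≠ ⊤)
    {g : ℕ → α → G} {B : ℝ} (hg : ∀ k, AEStronglyMeasurable (g k) μ)
    (hB : ∀ k, ∀ᵐ z ∂μ, ‖g k z‖ ≤ B) (hzero : ∀ k, ∀ᵐ z ∂μ, z ∉ s → g k z = 0)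
    (hlim : ∀ᵐ z ∂μ, Tendsto (fun k => g k z) atTop (𝓝 0)) {q : ℝ≥0∞} (hq : q < ⊤) :
    Tendsto (fun k => eLpNorm (g k) q μ) atTop (𝓝 0) := by
  by_cases hq0 : q = 0
  · simp [hq0]
  have hqpos : 0 < q.toReal := ENNReal.toReal_pos hq0 hq.ne
  have hpow : ∀ r : ℝ, 0 < r → Tendsto (fun x : ℝ≥0∞ => x ^ r) (𝓝 0) (𝓝 0) := fun r hr => by
    have := (ENNReal.continuous_rpow_const (y := r)).tendsto 0
    rwa [ENNReal.zero_rpow_of_pos hr] at this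
  have hint : Tendsto (fun k => ∫⁻ z, ‖g k z‖ₑ ^ q.toReal ∂μ) atTop (𝓝 (∫⁻ _, 0 ∂μ)) := by
    refine tendsto_lintegral_of_dominated_convergence'
      (s.indicator fun _ => ENNReal.ofReal B ^ q.toReal) (fun k => (hg k).enorm.pow_const _)
      (fun k => ?_) ?_ ?_
    · filter_upwards [hB k, hzero k] with z h1 h2
      by_cases hz : z ∈ s
      · rw [Set.indicator_of_mem hz, ← ofReal_norm]
        gcongr
      · simp [h2 hz, hqpos]
    · rw [lintegral_indicator hs, setLIntegral_const]
      exact ENNReal.mul_ne_top (ENNReal.rpow_ne_top_of_nonneg hqpos.le ENNReal.ofReal_ne_top) hμs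
    · filter_upwards [hlim] with z hz
      have h1 := hz.enorm
      rw [enorm_zero] at h1
      exact (hpow _ hqpos).comp h1
  rw [lintegral_zero] at hint
  have h2 := (hpow (1 / q.toReal) (by positivity)).comp hint
  refine h2.congr fun k => ?_
  rw [eLpNorm_eq_lintegral_rpow_enorm_toReal hq0 hq.ne]
  rfl

end Limit

section Convergence

variable {n : ℕ} {Ω : TopologicalSpace.Opens (SpaceTime n)} {F : ℕ → SpaceTime n → State n}
  {v : SpaceTime n → Space n} {p : SpaceTime n → ℝ}

theorem ae_tendsto_fluxError (hn : 0 < n) (hF : ∀ k, IsSubsolution Ω (F k))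
    (hv : ∀ᵐ z, Tendsto (fun k => (F k z).1) atTop (𝓝 (v z)))
    (hv1 : ∀ᵐ z, z ∈ Ω → ‖v z‖ = 1) :
    ∀ᵐ z, ∀ i j, Tendsto (fun k => fluxError (F k z) i j) atTop (𝓝 0) := by
  filter_upwards [hv, hv1] with z hz hz1 i j
  by_cases hzΩ : z ∈ Ω
  · refine squeeze_zero_norm (fun k => (hF k).abs_fluxError_le hn z i j) ?_
    have h := ((hz.norm.pow 2).const_sub 1).const_mul 2
    rw [hz1 hzΩ] at h
    simpa using h
  · simp [(hF _).eq_zero hzΩ, fluxError_zero]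

theorem tendsto_integral_fluxError_sq (hn : 0 < n)
    (hΩ : Bornology.IsBounded (Ω : Set (SpaceTime n))) (hF : ∀ k, IsSubsolution Ω (F k))
    (hD : ∀ᵐ z, ∀ i j, Tendsto (fun k => fluxError (F k z) i j) atTop (𝓝 0)) :
    Tendsto (fun k => ∫ z, ∑ i, ∑ j, fluxError (F k z) i j ^ 2) atTop (𝓝 0) := by
  have h := tendsto_integral_of_dominated_convergence (μ := (volume : Measure (SpaceTime n)))
    (F := fun k z => ∑ i, ∑ j, fluxError (F k z) i j ^ 2) (f := fun _ => 0)
    ((Ω : Set (SpaceTime n)).indicator fun _ => ∑ _i : Fin n, ∑ _j : Fin n, (2 : ℝ) ^ 2)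
    (fun k => (hF k).integrable_fluxError_sq.aestronglyMeasurable)
    ((integrable_indicator_iff Ω.isOpen.measurableSet).2
      (integrableOn_const hΩ.measure_lt_top.ne))
    (fun k => Eventually.of_forall fun z => ?_) ?_
  · simpa using h
  · by_cases hz : z ∈ (Ω : Set (SpaceTime n))
    · rw [Set.indicator_of_mem hz, Real.norm_eq_abs, abs_of_nonneg (Finset.sum_nonneg fun i _ =>
        Finset.sum_nonneg fun j _ => sq_nonneg _)]
      refine Finset.sum_le_sum fun i _ => Finset.sum_le_sum fun j _ => ?_
      rw [← sq_abs]
      exact pow_le_pow_left₀ (abs_nonneg _) ((hF k).abs_fluxError_le_two hn z i j) 2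
    · simp [Set.indicator_of_notMem hz, (hF k).eq_zero hz, fluxError_zero]
  · filter_upwards [hD] with z hz
    have h := tendsto_finsetSum Finset.univ fun i _ => tendsto_finsetSum Finset.univ fun j _ =>
      (hz i j).pow 2
    simpa using h

theorem IsSubsolution.abs_flux_le {G : SpaceTime n → State n} (hn : 0 < n)
    (hG : IsSubsolution Ω G) {z : SpaceTime n} (hT : |fluxTrace (G z)| ≤ 2) (i j : Fin n) :
    |(G z).2 i j| ≤ 6 := by
  have hv : ∀ i, |(G z).1 i| ≤ 1 := fun i =>
    (abs_velocity_le _ i).trans (hG.norm_velocity_le hn z)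
  have h1 : |(G z).1 i * (G z).1 j| ≤ 1 := by
    rw [abs_mul]
    exact mul_le_one₀ (hv i) (abs_nonneg _) (hv j)
  have h2 : |(if i = j then (1 : ℝ) else 0) * pressure (G z)| ≤ 3 := by
    have := hG.abs_pressure_le hn hT
    split_ifs
    · rwa [one_mul]
    · simp
  have h3 := hG.abs_fluxError_le_two hn z i j
  rw [flux_eq]
  refine (abs_sub _ _).trans ?_
  have := abs_add_le ((G z).1 i * (G z).1 j) ((if i = j then (1 : ℝ) else 0) * pressure (G z))
  linarith

theorem integral_momentum_of_tendsto (hn : 0 < n) (hF : ∀ k, IsSubsolution Ω (F k))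
    (hT : ∀ k z, |fluxTrace (F k z)| ≤ 2)
    (hv : ∀ᵐ z, Tendsto (fun k => (F k z).1) atTop (𝓝 (v z)))
    (hp : ∀ᵐ z, Tendsto (fun k => pressure (F k z)) atTop (𝓝 (p z)))
    (hD : ∀ᵐ z, ∀ i j, Tendsto (fun k => fluxError (F k z) i j) atTop (𝓝 0))
    (φ : 𝓓((⊤ : TopologicalSpace.Opens (SpaceTime n)), Space n)) :
    ∫ z, ((∑ i, v z i * dt (fun y => φ y i) z)
      + ∑ i, ∑ j, (v z i * v z j + (if i = j then 1 else 0) * p z) * dx j (fun y => φ y i) z)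
      = 0 := by
  have hdt : ∀ i, Integrable (dt fun y => φ y i) := fun i => integrable_dirDeriv_test φ _ i
  have hdx : ∀ i j, Integrable (dx j fun y => φ y i) := fun i j =>
    integrable_dirDeriv_test φ _ i
  have hlim := tendsto_integral_of_dominated_convergence
    (μ := (volume : Measure (SpaceTime n)))
    (F := fun k z => (∑ i, (F k z).1 i * dt (fun y => φ y i) z)
      + ∑ i, ∑ j, (F k z).2 i j * dx j (fun y => φ y i) z)
    (f := fun z => (∑ i, v z i * dt (fun y => φ y i) z)
      + ∑ i, ∑ j, (v z i * v z j + (if i = j then 1 else 0) * p z) * dx j (fun y => φ y i) z)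
    (fun z => (∑ i, |dt (fun y => φ y i) z|) + ∑ i, ∑ j, 6 * |dx j (fun y => φ y i) z|)
    (fun k => ?_) ?_ (fun k => Eventually.of_forall fun z => ?_) ?_
  · simp only [fun k => integral_linear_momentum φ (hF k).toIsLinearSolution] at hlim
    exact tendsto_nhds_unique hlim tendsto_const_nhds
  · apply Continuous.aestronglyMeasurable
    have h1 := fun i => (contDiff_velocity (hF k).smooth i).continuous
    have h2 := fun i j => (contDiff_flux (hF k).smooth i j).continuous
    have h3 := fun i => continuous_dt (contDiff_testComponent φ i)
    have h4 := fun i j => continuous_dx (contDiff_testComponent φ i) j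
    exact (continuous_finsetSum _ fun i _ => (h1 i).mul (h3 i)).add
      (continuous_finsetSum _ fun i _ => continuous_finsetSum _ fun j _ => (h2 i j).mul (h4 i j))
  · exact (integrable_finsetSum _ fun i _ => (hdt i).abs).add
      (integrable_finsetSum _ fun i _ => integrable_finsetSum _ fun j _ =>
        (hdx i j).abs.const_mul 6)
  · rw [Real.norm_eq_abs]
    refine (abs_add_le _ _).trans (add_le_add ?_ ?_)
    · refine (Finset.abs_sum_le_sum_abs _ _).trans (Finset.sum_le_sum fun i _ => ?_)
      rw [abs_mul]
      exact mul_le_of_le_one_left (abs_nonneg _)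
        ((abs_velocity_le _ i).trans ((hF k).norm_velocity_le hn z))
    · refine (Finset.abs_sum_le_sum_abs _ _).trans (Finset.sum_le_sum fun i _ =>
        (Finset.abs_sum_le_sum_abs _ _).trans (Finset.sum_le_sum fun j _ => ?_))
      rw [abs_mul]
      exact mul_le_mul_of_nonneg_right ((hF k).abs_flux_le hn (hT k z) i j) (abs_nonneg _)
  · filter_upwards [hv, hp, hD] with z hz hpz hDz
    have hvi : ∀ i, Tendsto (fun k => (F k z).1 i) atTop (𝓝 (v z i)) := fun i =>
      ((EuclideanSpace.proj (𝕜 := ℝ) i : Space n →L[ℝ] ℝ).continuous.tendsto _).comp hz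
    have hM : ∀ i j, Tendsto (fun k => (F k z).2 i j) atTop
        (𝓝 (v z i * v z j + (if i = j then 1 else 0) * p z)) := fun i j => by
      have h := (((hvi i).mul (hvi j)).add (hpz.const_mul (if i = j then 1 else 0))).sub
        (hDz i j)
      rw [sub_zero] at h
      exact h.congr fun k => (flux_eq (F k z) i j).symm
    exact (tendsto_finsetSum _ fun i _ => (hvi i).mul_const _).add
      (tendsto_finsetSum _ fun i _ => tendsto_finsetSum _ fun j _ => (hM i j).mul_const _)

theorem integral_incompressible_of_tendsto (hn : 0 < n) (hF : ∀ k, IsSubsolution Ω (F k))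
    (hv : ∀ᵐ z, Tendsto (fun k => (F k z).1) atTop (𝓝 (v z)))
    (ψ : 𝓓((⊤ : TopologicalSpace.Opens (SpaceTime n)), ℝ)) :
    ∫ z, ∑ j, v z j * dx j ψ z = 0 := by
  have hψ : ContDiff ℝ ∞ ψ := ψ.contDiff
  have hdx : ∀ j, Integrable (dx j ψ) := fun j =>
    (contDiff_dirDeriv hψ _).continuous.integrable_of_hasCompactSupport
      (hasCompactSupport_dirDeriv ψ.hasCompactSupport _)
  have hlim := tendsto_integral_of_dominated_convergence
    (μ := (volume : Measure (SpaceTime n))) (F := fun k z => ∑ j, (F k z).1 j * dx j ψ z)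
    (f := fun z => ∑ j, v z j * dx j ψ z) (fun z => ∑ j, |dx j ψ z|)
    (fun k => ?_) ?_ (fun k => Eventually.of_forall fun z => ?_) ?_
  · simp only [fun k => integral_linear_incompressible (hF k).toIsLinearSolution ψ] at hlim
    exact tendsto_nhds_unique hlim tendsto_const_nhds
  · apply Continuous.aestronglyMeasurable
    have h1 := fun i => (contDiff_velocity (hF k).smooth i).continuous
    exact continuous_finsetSum _ fun j _ => (h1 j).mul (continuous_dx hψ j)
  · exact integrable_finsetSum _ fun j _ => (hdx j).abs
  · rw [Real.norm_eq_abs]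
    refine (Finset.abs_sum_le_sum_abs _ _).trans (Finset.sum_le_sum fun i _ => ?_)
    rw [abs_mul]
    exact mul_le_of_le_one_left (abs_nonneg _)
      ((abs_velocity_le _ i).trans ((hF k).norm_velocity_le hn z))
  · filter_upwards [hv] with z hz
    exact tendsto_finsetSum _ fun i _ =>
      (((EuclideanSpace.proj (𝕜 := ℝ) i : Space n →L[ℝ] ℝ).continuous.tendsto _).comp
        hz).mul_const _

theorem isWeakSolution_of_tendsto (hn : 0 < n) (hF : ∀ k, IsSubsolution Ω (F k))
    (hT : ∀ k z, |fluxTrace (F k z)| ≤ 2)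
    (hvLp : MemLp v ⊤ volume) (hpLp : MemLp p ⊤ volume) (hv1 : ∀ᵐ z, ‖v z‖ ≤ 1)
    (hv : ∀ᵐ z, Tendsto (fun k => (F k z).1) atTop (𝓝 (v z)))
    (hp : ∀ᵐ z, Tendsto (fun k => pressure (F k z)) atTop (𝓝 (p z)))
    (hD : ∀ᵐ z, ∀ i j, Tendsto (fun k => fluxError (F k z) i j) atTop (𝓝 0)) :
    IsWeakSolution v p (fun _ => 0) where
  aestronglyMeasurable := hvLp.1
  sq_locallyIntegrable := by
    have h : MemLp (fun z => ‖v z‖ ^ 2) ⊤ volume := by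
      refine memLp_top_of_bound (hvLp.1.norm.pow 2) 1 ?_
      filter_upwards [hv1] with z hz
      rw [norm_pow, norm_norm]
      exact pow_le_one₀ (norm_nonneg _) hz
    exact h.locallyIntegrable le_top
  pressure_locallyIntegrable := hpLp.locallyIntegrable le_top
  force_locallyIntegrable := locallyIntegrable_const _
  momentum φ := by
    rw [← integral_momentum_of_tendsto hn hF hT hv hp hD φ]
    congr 1
    funext z
    simp only [PiLp.zero_apply, zero_mul, Finset.sum_const_zero, add_zero, add_mul, ite_mul,
      one_mul, Finset.sum_add_distrib, Finset.sum_ite_eq, Finset.mem_univ, if_true, divx,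
      Finset.mul_sum, add_assoc]
  incompressible := integral_incompressible_of_tendsto hn hF hv

end Convergence

end Euler

end

open Euler in
theorem theorem4p1 (n : ℕ) (hn : 2 ≤ n) (Ω : TopologicalSpace.Opens (Euler.SpaceTime n))
    (hΩ : Bornology.IsBounded (Ω : Set (Euler.SpaceTime n))) :
    ∃ (v : Euler.SpaceTime n → Euler.Space n) (p : Euler.SpaceTime n → ℝ),
      MemLp v ∞ volume ∧ MemLp p ∞ volume ∧
      Euler.IsWeakSolution v p (fun _ => 0) ∧
      (∀ᵐ z ∂(volume : Measure (Euler.SpaceTime n)), z ∈ Ω → ‖v z‖ = 1) ∧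
      (∀ᵐ z ∂(volume : Measure (Euler.SpaceTime n)), z ∉ Ω → v z = 0 ∧ p z = 0) ∧
      ∃ (vk : ℕ → 𝓓(Ω, Euler.Space n)) (pk : ℕ → 𝓓(Ω, ℝ)) (fk : ℕ → 𝓓(Ω, Euler.Space n)),
        (∀ k, Euler.IsClassicalSolution (vk k) (pk k) (fk k)) ∧
        Tendsto (fun k => Euler.hNegOneNorm (fk k)) atTop (𝓝 0) ∧
        (∃ C : ℝ≥0, ∀ k, eLpNorm (vk k) ∞ volume + eLpNorm (pk k) ∞ volume ≤ C) ∧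
        (∀ q : ℝ≥0∞, q < ∞ →
          Tendsto (fun k => eLpNorm (fun z => vk k z - v z) q volume) atTop (𝓝 0) ∧
          Tendsto (fun k => eLpNorm (fun z => pk k z - p z) q volume) atTop (𝓝 0)) := by
  have hn0 : 0 < n := by omega
  obtain ⟨F, v, T, hF, hvm, hT, hTlim, hv, hv1⟩ := exists_convergent_subsolution_seq hn hΩ
  let p : SpaceTime n → ℝ := fun z => (T z - ‖v z‖ ^ 2) / n
  have hp : ∀ᵐ z, Tendsto (fun k => pressure (F k z)) atTop (𝓝 (p z)) := by
    filter_upwards [hv] with z hz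
    exact ((hTlim z).sub (hz.norm.pow 2)).div_const _
  have hpm : AEStronglyMeasurable p volume :=
    aestronglyMeasurable_of_tendsto_ae atTop
      (fun k => (contDiff_pressure (hF k).smooth).continuous.aestronglyMeasurable) hp
  have hvle : ∀ᵐ z, ‖v z‖ ≤ 1 := by
    filter_upwards [hv] with z hz
    exact le_of_tendsto' hz.norm fun k => (hF k).norm_velocity_le hn0 z
  have hple : ∀ᵐ z, ‖p z‖ ≤ 3 := by
    filter_upwards [hp] with z hz
    exact le_of_tendsto' hz.norm fun k => (hF k).abs_pressure_le hn0 (hT k z)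
  have hout : ∀ᵐ z, z ∉ Ω → v z = 0 ∧ p z = 0 := by
    filter_upwards [hv, hp] with z hz hpz hzΩ
    constructor
    · refine tendsto_nhds_unique hz ?_
      simp [(hF _).eq_zero hzΩ]
    · refine tendsto_nhds_unique hpz ?_
      simp [(hF _).eq_zero hzΩ, pressure_zero]
  have hvLp : MemLp v ∞ volume := memLp_top_of_bound hvm 1 hvle
  have hpLp : MemLp p ∞ volume := memLp_top_of_bound hpm 3 hple
  have hD := ae_tendsto_fluxError hn0 hF hv hv1
  refine ⟨v, p, hvLp, hpLp, isWeakSolution_of_tendsto hn0 hF hT hvLp hpLp hvle hv hp hD, hv1,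
    hout, fun k => velocityTest (hF k), fun k => pressureTest (hF k), fun k => forceTest (hF k),
    fun k => isClassicalSolution (hF k).toIsLinearSolution,
    tendsto_hNegOneNorm_fluxForce (fun k => (hF k).toIsLinearSolution)
      (tendsto_integral_fluxError_sq hn0 hΩ hF hD), ⟨1 + 3, fun k => ?_⟩, fun q hq => ⟨?_, ?_⟩⟩
  · have h1 : eLpNorm (velocityTest (hF k)) ∞ volume ≤ ENNReal.ofReal 1 := by
      rw [eLpNorm_exponent_top]
      exact eLpNormEssSup_le_of_ae_bound
        (Eventually.of_forall fun z => (hF k).norm_velocity_le hn0 z)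
    have h2 : eLpNorm (pressureTest (hF k)) ∞ volume ≤ ENNReal.ofReal 3 := by
      rw [eLpNorm_exponent_top]
      exact eLpNormEssSup_le_of_ae_bound
        (Eventually.of_forall fun z => (hF k).abs_pressure_le hn0 (hT k z))
    refine (add_le_add h1 h2).trans (le_of_eq ?_)
    simp
  · refine tendsto_eLpNorm_zero_of_bounded (B := 2) Ω.isOpen.measurableSet hΩ.measure_lt_top.ne
      (fun k => (velocityTest (hF k)).continuous.aestronglyMeasurable.sub hvm) (fun k => ?_)
      (fun k => ?_) ?_ hq
    · filter_upwards [hvle] with z hz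
      have := (hF k).norm_velocity_le hn0 z
      refine (norm_sub_le _ _).trans ?_
      change ‖(F k z).1‖ + ‖v z‖ ≤ 2
      linarith
    · filter_upwards [hout] with z hz hzΩ
      change (F k z).1 - v z = 0
      rw [(hF k).eq_zero hzΩ, (hz hzΩ).1]
      simp
    · filter_upwards [hv] with z hz
      have := hz.sub_const (v z)
      rwa [sub_self] at this
  · refine tendsto_eLpNorm_zero_of_bounded (B := 6) Ω.isOpen.measurableSet hΩ.measure_lt_top.ne
      (fun k => (pressureTest (hF k)).continuous.aestronglyMeasurable.sub hpm) (fun k => ?_)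
      (fun k => ?_) ?_ hq
    · filter_upwards [hple] with z hz
      have := (hF k).abs_pressure_le hn0 (hT k z)
      refine (norm_sub_le _ _).trans ?_
      change |pressure (F k z)| + ‖p z‖ ≤ 6
      linarith
    · filter_upwards [hout] with z hz hzΩ
      change pressure (F k z) - p z = 0
      rw [(hF k).eq_zero hzΩ, (hz hzΩ).2, pressure_zero, sub_zero]
    · filter_upwards [hp] with z hz
      have := hz.sub_const (p z)
      rwa [sub_self] at this
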